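/- Let $(X,\mathcal F,\mu)$ be a $\sigma$-finite measure space and let $\Phi:\mathbb R\to[0,\infty]$ be a Young function, i.e. $\Phi$ is convex and even, $\Phi(0)=0$ and $\Phi(x)\to\infty$ as $x\to\infty$. Assume $\Phi\in\Delta'$: there are $c>0$ and $x_0\ge 0$ with $\Phi(xy)\le c\,\Phi(x)\Phi(y)$ for all $x,y\ge x_0$. Write $\Phi^{-1}(y)=\inf\{x\ge 0:\Phi(x)>y\}$, let $L^\Phi(\mu)$ be the real Orlicz space of classes of measurable $f:X\to\mathbb R$ with $\int_X\Phi(kf)\,d\mu<\infty$ for some $k>0$, and equip it with the gauge norm $N_\Phi(f)=\inf\{k>0:\int_X\Phi(f/k)\,d\mu\le 1\}$. Let $\varphi:X\to X$ be a bijection with $\varphi$ and $\varphi^{-1}$ measurable, such that for some $c>0$ both $\mu(\varphi^{-1}(A))\le c\,\mu(A)$ and $\mu(\varphi(A))\le c\,\mu(A)$ hold for all $A\in\mathcal F$, and let $C_\varphi f=f\circ\varphi$ on $L^\Phi(\mu)$. Assume that the system is dissipative of bounded distortion, generated by a set $W\in\mathcal F$ with $0<\mu(W)<\infty$: the sets $\varphi^k(W)$,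 $k\in\mathbb Z$, are pairwise disjoint with union $X$, and there is $K>0$ such that $$\frac1K\,\frac{N_\Phi(\chi_W\circ\varphi^k)}{N_\Phi(\chi_W)}\le\frac{N_\Phi(\chi_F\circ\varphi^k)}{N_\Phi(\chi_F)}\le K\,\frac{N_\Phi(\chi_W\circ\varphi^k)}{N_\Phi(\chi_W)}$$ for all $k\in\mathbb Z$ and all measurable $F\subseteq W$ with $\mu(F)>0$. Put $u_k=\Phi^{-1}\big(1/\mu(\varphi^k(W))\big)$ for $k\in\mathbb Z$, and suppose that at least one of the following conditions holds: (hc) $\displaystyle\limsup_{n\to\infty}\ \sup_{k\in\mathbb Z}\Big(\frac{u_{k+n}}{u_k}\Big)^{1/n}<1$; (hd) $\displaystyle\liminf_{n\to\infty}\ \inf_{k\in\mathbb Z}\Big(\frac{u_{k+n}}{u_k}\Big)^{1/n}>1$; (gh) $\displaystyle\limsup_{n\to\infty}\ \sup_{k\le 0}\Big(\frac{u_k}{u_{k-n}}\Big)^{1/n}<1$, and in addition either $\displaystyle\liminf_{n\to\infty}\ \inf_{k\ge 0}\Big(\frac{u_{k+n}}{u_k}\Big)^{1/n}>1$ or $\displaystyle\liminf_{n\to\infty}\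 \inf_{k\ge 0}\Big(\frac{u_k}{u_{k+n}}\Big)^{1/n}>1$. Then $C_\varphi$ is strongly structurally stable on $L^\Phi(\mu)$: it is an invertible bounded operator, and for every $\varepsilon>0$ there is $\delta>0$ such that for every Lipschitz map $\alpha:L^\Phi(\mu)\to L^\Phi(\mu)$ with $\sup_f N_\Phi(\alpha(f))\le\delta$ and Lipschitz constant at most $\delta$ there is a homeomorphism $h$ of $L^\Phi(\mu)$ with $h\circ C_\varphi=(C_\varphi+\alpha)\circ h$ and $\sup_f N_\Phi(h(f)-f)\le\varepsilon$. -/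

import Mathlib

open MeasureTheory Filter Topology
open scoped NNReal ENNReal

noncomputable section

/-- A Young function: an even convex function `Φ : ℝ → [0, ∞]` with `Φ 0 = 0` and
`Φ x → ∞` as `x → ∞`. -/
structure YoungFunction where
  toFun : ℝ → ℝ≥0∞
  convex : ConvexOn ℝ≥0 Set.univ toFun
  even : ∀ x, toFun (-x) = toFun x
  map_zero : toFun 0 = 0
  tendsto_top : Tendsto toFun atTop (𝓝 ∞)

namespace YoungFunction

instance : CoeFun YoungFunction (fun _ => ℝ → ℝ≥0∞) := ⟨toFun⟩

/-- The growth condition `Δ'`: there are `c > 0` and `x₀ ≥ 0` with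
`Φ (x y) ≤ c Φ(x) Φ(y)` for all `x, y ≥ x₀`. -/
def DeltaPrime (Φ : YoungFunction) : Prop :=
  ∃ c : ℝ≥0, 0 < c ∧ ∃ x₀ : ℝ, 0 ≤ x₀ ∧ ∀ x y : ℝ, x₀ ≤ x → x₀ ≤ y →
    Φ (x * y) ≤ c * (Φ x * Φ y)

/-- The generalized inverse `Φ⁻¹(y) = inf {x ≥ 0 : Φ(x) > y}`. -/
def inverse (Φ : YoungFunction) (y : ℝ≥0∞) : ℝ≥0∞ :=
  ⨅ (x : ℝ≥0) (_ : y < Φ (x : ℝ)), (x : ℝ≥0∞)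

lemma smul_le (Φ : YoungFunction) (t : ℝ≥0) (ht : t ≤ 1) (x : ℝ) :
    Φ ((t : ℝ) * x) ≤ t * Φ x := by
  have h : Φ (t • x + (1 - t) • (0 : ℝ)) ≤ t • Φ x + (1 - t) • Φ 0 :=
    Φ.convex.2 (Set.mem_univ x) (Set.mem_univ (0 : ℝ)) zero_le zero_le
      (add_tsub_cancel_of_le ht)
  simpa [Φ.map_zero, NNReal.smul_def, ENNReal.smul_def] using h

lemma mono (Φ : YoungFunction) {x y : ℝ} (hx : 0 ≤ x) (hxy : x ≤ y) : Φ x ≤ Φ y := by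
  rcases hx.eq_or_lt with rfl | h0
  · simp [Φ.map_zero]
  have hy : 0 < y := h0.trans_le hxy
  obtain ⟨t, ht'⟩ : ∃ t : ℝ≥0, (t : ℝ) = x / y := ⟨(x / y).toNNReal,
    Real.coe_toNNReal _ (by positivity)⟩
  have ht : t ≤ 1 := by
    rw [← NNReal.coe_le_coe, ht']; simpa using (div_le_one hy).2 hxy
  have h := Φ.smul_le t ht y
  rw [ht', div_mul_cancel₀ _ hy.ne'] at h
  refine h.trans ?_
  calc _ ≤ (1 : ℝ≥0∞) * Φ y := by gcongr; exact_mod_cast ht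
    _ = Φ y := one_mul _

lemma map_abs (Φ : YoungFunction) (x : ℝ) : Φ |x| = Φ x := by
  rcases abs_choice x with h | h <;> rw [h]
  exact Φ.even x

lemma measurable (Φ : YoungFunction) : Measurable Φ.toFun := by
  have h : Monotone (fun x : ℝ => Φ (max x 0)) := fun x y hxy =>
    Φ.mono (le_max_right _ _) (max_le_max_right _ hxy)
  have e : Φ.toFun = (fun x : ℝ => Φ (max x 0)) ∘ (fun x : ℝ => |x|) := by
    funext x; simp [Φ.map_abs]
  rw [e]
  exact h.measurable.comp measurable_norm

end YoungFunction

variable {X : Type*} [MeasurableSpace X]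

/-- The modular `ρ_Φ(f) = ∫ Φ(f) dμ`. -/
def orliczModular (Φ : YoungFunction) (μ : Measure X) (f : X → ℝ) : ℝ≥0∞ :=
  ∫⁻ x, Φ (f x) ∂μ

/-- The gauge (Luxemburg) functional `N_Φ(f) = inf {k > 0 : ρ_Φ(f / k) ≤ 1}`. -/
def gaugeNorm (Φ : YoungFunction) (μ : Measure X) (f : X → ℝ) : ℝ :=
  sInf {k : ℝ | 0 < k ∧ orliczModular Φ μ (fun x => f x / k) ≤ 1}

section Modular

variable (Φ : YoungFunction) (μ : Measure X)

lemma orliczModular_congr {f g : X → ℝ} (h : f =ᵐ[μ] g) :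
    orliczModular Φ μ f = orliczModular Φ μ g :=
  lintegral_congr_ae (h.mono fun x hx => by simp [hx])

lemma gaugeNorm_congr {f g : X → ℝ} (h : f =ᵐ[μ] g) : gaugeNorm Φ μ f = gaugeNorm Φ μ g := by
  unfold gaugeNorm
  congr 1
  ext k
  rw [Set.mem_ofPred_eq, Set.mem_ofPred_eq,
    orliczModular_congr Φ μ (f := fun x => f x / k) (g := fun x => g x / k)
      (h.mono fun x hx => by simp [hx])]

lemma orliczModular_mono {f g : X → ℝ} (h : ∀ x, |f x| ≤ |g x|) :
    orliczModular Φ μ f ≤ orliczModular Φ μ g := by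
  refine lintegral_mono fun x => ?_
  rw [← Φ.map_abs (f x), ← Φ.map_abs (g x)]
  exact Φ.mono (abs_nonneg _) (h x)

lemma orliczModular_smul_le (t : ℝ≥0) (ht : t ≤ 1) (f : X → ℝ) :
    orliczModular Φ μ (fun x => (t : ℝ) * f x) ≤ t * orliczModular Φ μ f := by
  unfold orliczModular
  rw [← lintegral_const_mul' _ _ ENNReal.coe_ne_top]
  exact lintegral_mono fun x => Φ.smul_le t ht _

lemma orliczModular_convex {f g : X → ℝ} (hf : AEMeasurable f μ) (s t : ℝ≥0) (hst : s + t = 1) :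
    orliczModular Φ μ (fun x => (s : ℝ) * f x + (t : ℝ) * g x) ≤
      s * orliczModular Φ μ f + t * orliczModular Φ μ g := by
  unfold orliczModular
  rw [← lintegral_const_mul' _ _ ENNReal.coe_ne_top,
    ← lintegral_const_mul' (t : ℝ≥0∞) _ ENNReal.coe_ne_top,
    ← lintegral_add_left' (f := fun x => (s : ℝ≥0∞) * Φ (f x))
      ((Φ.measurable.comp_aemeasurable hf).const_mul _)]
  refine lintegral_mono fun x => ?_
  have h : Φ (s • f x + t • g x) ≤ s • Φ (f x) + t • Φ (g x) :=
    Φ.convex.2 (Set.mem_univ (f x)) (Set.mem_univ (g x)) zero_le zero_le hst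
  simpa [NNReal.smul_def, ENNReal.smul_def] using h

lemma gaugeNorm_nonneg (f : X → ℝ) : 0 ≤ gaugeNorm Φ μ f :=
  Real.sInf_nonneg fun _ hk => hk.1.le

lemma gaugeNorm_le {f : X → ℝ} {k : ℝ} (hk : 0 < k)
    (h : orliczModular Φ μ (fun x => f x / k) ≤ 1) : gaugeNorm Φ μ f ≤ k :=
  csInf_le ⟨0, fun _ hk => hk.1.le⟩ ⟨hk, h⟩

lemma gaugeSet_nonempty {f : X → ℝ}
    (h : ∃ k : ℝ, 0 < k ∧ orliczModular Φ μ (fun x => k * f x) < ∞) :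
    {k : ℝ | 0 < k ∧ orliczModular Φ μ (fun x => f x / k) ≤ 1}.Nonempty := by
  obtain ⟨k, hk, hfin⟩ := h
  set m : ℝ≥0 := (orliczModular Φ μ (fun x => k * f x)).toNNReal with hm
  have hm' : orliczModular Φ μ (fun x => k * f x) = m := (ENNReal.coe_toNNReal hfin.ne).symm
  set t : ℝ≥0 := (1 + m)⁻¹ with ht
  have ht0 : 0 < t := by positivity
  have ht1 : t ≤ 1 := inv_le_one_of_one_le₀ (by simp)
  refine ⟨((t : ℝ) * k)⁻¹, by positivity, ?_⟩
  have e : (fun x => f x / ((t : ℝ) * k)⁻¹) = fun x => (t : ℝ) * (k * f x) := by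
    funext x; rw [div_inv_eq_mul]; ring
  rw [e]
  refine (orliczModular_smul_le Φ μ t ht1 _).trans ?_
  rw [hm']
  have : t * m ≤ 1 := by
    rw [ht, inv_mul_le_iff₀ (by positivity)]; simp
  exact_mod_cast this

lemma modular_le_one_of_gaugeNorm_lt {f : X → ℝ} {a : ℝ}
    (h : ∃ k : ℝ, 0 < k ∧ orliczModular Φ μ (fun x => k * f x) < ∞)
    (ha : gaugeNorm Φ μ f < a) : orliczModular Φ μ (fun x => f x / a) ≤ 1 := by
  obtain ⟨k, ⟨hk, hk1⟩, hka⟩ := exists_lt_of_csInf_lt (gaugeSet_nonempty Φ μ h) ha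
  refine (orliczModular_mono Φ μ fun x => ?_).trans hk1
  rw [abs_div, abs_div, abs_of_pos hk, abs_of_pos (hk.trans hka)]
  gcongr

end Modular

/-- The Orlicz space `L^Φ(μ)` of (classes of) measurable functions `f : X → ℝ` with
`ρ_Φ(k f) < ∞` for some `k > 0`. -/
def OrliczSpace (Φ : YoungFunction) (μ : Measure X) : Submodule ℝ (X →ₘ[μ] ℝ) where
  carrier := {f | ∃ k : ℝ, 0 < k ∧ orliczModular Φ μ (fun x => k * f x) < ∞}
  zero_mem' := by
    refine ⟨1, one_pos, ?_⟩
    rw [orliczModular_congr Φ μ (g := fun _ => 0)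
      ((AEEqFun.coeFn_zero (α := X) (β := ℝ) (μ := μ)).mono fun x hx => by simp [hx])]
    simp [orliczModular, Φ.map_zero]
  add_mem' := by
    rintro f g ⟨a, ha, hfa⟩ ⟨b, hb, hgb⟩
    have hc : 0 < min a b := lt_min ha hb
    refine ⟨min a b / 2, by positivity, ?_⟩
    have e : orliczModular Φ μ (fun x => min a b / 2 * (f + g : X →ₘ[μ] ℝ) x) =
        orliczModular Φ μ (fun x => ((1 / 2 : ℝ≥0) : ℝ) * (min a b * f x) +
          ((1 / 2 : ℝ≥0) : ℝ) * (min a b * g x)) :=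
      orliczModular_congr Φ μ ((AEEqFun.coeFn_add f g).mono fun x hx => by
        simp only [hx, Pi.add_apply]; push_cast; ring)
    rw [e]
    refine (orliczModular_convex Φ μ (f.aestronglyMeasurable.aemeasurable.const_mul _) _ _
      (add_halves 1)).trans_lt ?_
    have h1 : orliczModular Φ μ (fun x => min a b * f x) < ∞ :=
      (orliczModular_mono Φ μ fun x => by
        rw [abs_mul, abs_mul, abs_of_pos hc, abs_of_pos ha]; gcongr; simp).trans_lt hfa
    have h2 : orliczModular Φ μ (fun x => min a b * g x) < ∞ :=
      (orliczModular_mono Φ μ fun x => by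
        rw [abs_mul, abs_mul, abs_of_pos hc, abs_of_pos hb]; gcongr; simp).trans_lt hgb
    exact ENNReal.add_lt_top.2
      ⟨ENNReal.mul_lt_top ENNReal.coe_lt_top h1, ENNReal.mul_lt_top ENNReal.coe_lt_top h2⟩
  smul_mem' := by
    rintro c f ⟨a, ha, hfa⟩
    have hc : 0 < |c| + 1 := by positivity
    refine ⟨a / (|c| + 1), by positivity, ?_⟩
    rw [orliczModular_congr Φ μ (g := fun x => a / (|c| + 1) * (c * f x))
      ((AEEqFun.coeFn_smul c f).mono fun x hx => by simp [hx])]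
    refine (orliczModular_mono Φ μ fun x => ?_).trans_lt hfa
    have e : a / (|c| + 1) * (c * f x) = (c / (|c| + 1)) * (a * f x) := by ring
    rw [e, abs_mul (c / (|c| + 1))]
    refine mul_le_of_le_one_left (abs_nonneg _) ?_
    rw [abs_div, abs_of_pos hc, div_le_one hc]
    linarith

section Space

variable (Φ : YoungFunction) (μ : Measure X)

instance OrliczSpace.instNorm : Norm (OrliczSpace Φ μ) := ⟨fun f => gaugeNorm Φ μ (f : X →ₘ[μ] ℝ)⟩

lemma OrliczSpace.norm_def (f : OrliczSpace Φ μ) : ‖f‖ = gaugeNorm Φ μ (f : X →ₘ[μ] ℝ) := rfl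

lemma gaugeNorm_add_le (f g : OrliczSpace Φ μ) : ‖f + g‖ ≤ ‖f‖ + ‖g‖ := by
  refine le_of_forall_pos_le_add fun ε hε => ?_
  have hf0 := gaugeNorm_nonneg Φ μ (f : X →ₘ[μ] ℝ)
  have hg0 := gaugeNorm_nonneg Φ μ (g : X →ₘ[μ] ℝ)
  simp only [OrliczSpace.norm_def] at *
  set a := gaugeNorm Φ μ (f : X →ₘ[μ] ℝ) + ε / 2 with ha
  set b := gaugeNorm Φ μ (g : X →ₘ[μ] ℝ) + ε / 2 with hb
  have ha0 : 0 < a := by positivity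
  have hb0 : 0 < b := by positivity
  have h1 := modular_le_one_of_gaugeNorm_lt Φ μ (a := a) f.2 (by linarith)
  have h2 := modular_le_one_of_gaugeNorm_lt Φ μ (a := b) g.2 (by linarith)
  have hab : 0 < a + b := by positivity
  have hle : gaugeNorm Φ μ ((f + g : OrliczSpace Φ μ) : X →ₘ[μ] ℝ) ≤ a + b := by
    refine gaugeNorm_le Φ μ hab ?_
    set s : ℝ≥0 := ⟨a / (a + b), by positivity⟩
    set t : ℝ≥0 := ⟨b / (a + b), by positivity⟩
    have hst : s + t = 1 := by
      rw [← NNReal.coe_inj]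
      change a / (a + b) + b / (a + b) = 1
      field_simp
    have e : orliczModular Φ μ (fun x => ((f + g : OrliczSpace Φ μ) : X →ₘ[μ] ℝ) x / (a + b)) =
        orliczModular Φ μ (fun x => (s : ℝ) * ((f : X →ₘ[μ] ℝ) x / a) +
          (t : ℝ) * ((g : X →ₘ[μ] ℝ) x / b)) :=
      orliczModular_congr Φ μ ((AEEqFun.coeFn_add (f : X →ₘ[μ] ℝ) (g : X →ₘ[μ] ℝ)).mono
        fun x hx => by
          change ((f : X →ₘ[μ] ℝ) + (g : X →ₘ[μ] ℝ) : X →ₘ[μ] ℝ) x / (a + b) =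
            a / (a + b) * ((f : X →ₘ[μ] ℝ) x / a) + b / (a + b) * ((g : X →ₘ[μ] ℝ) x / b)
          rw [hx, Pi.add_apply]
          field_simp)
    rw [e]
    refine (orliczModular_convex Φ μ
      ((f : X →ₘ[μ] ℝ).aestronglyMeasurable.aemeasurable.div_const _) s t hst).trans ?_
    calc _ ≤ (s : ℝ≥0∞) * 1 + t * 1 := by gcongr
      _ = 1 := by rw [mul_one, mul_one]; exact_mod_cast hst
  linarith

lemma gaugeNorm_smul_le (c : ℝ) (hc : c ≠ 0) (f : OrliczSpace Φ μ) : ‖c • f‖ ≤ |c| * ‖f‖ := by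
  have hc0 : 0 < |c| := abs_pos.2 hc
  refine le_of_forall_pos_le_add fun ε hε => ?_
  have hf0 := gaugeNorm_nonneg Φ μ (f : X →ₘ[μ] ℝ)
  simp only [OrliczSpace.norm_def] at *
  set a := gaugeNorm Φ μ (f : X →ₘ[μ] ℝ) + ε / |c| with ha
  have ha0 : 0 < a := by positivity
  have h1 := modular_le_one_of_gaugeNorm_lt Φ μ (a := a) f.2 (by linarith [div_pos hε hc0])
  have : gaugeNorm Φ μ ((c • f : OrliczSpace Φ μ) : X →ₘ[μ] ℝ) ≤ |c| * a := by
    refine gaugeNorm_le Φ μ (by positivity) (le_trans ?_ h1)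
    rw [orliczModular_congr Φ μ (g := fun x => c * (f : X →ₘ[μ] ℝ) x / (|c| * a))
      ((AEEqFun.coeFn_smul c (f : X →ₘ[μ] ℝ)).mono fun x hx => by
        change (c • (f : X →ₘ[μ] ℝ) : X →ₘ[μ] ℝ) x / _ = _
        rw [hx]; rfl)]
    refine orliczModular_mono Φ μ fun x => le_of_eq ?_
    rw [abs_div, abs_mul, abs_mul, abs_abs, abs_div]
    field_simp
  calc _ ≤ |c| * a := this
    _ = |c| * gaugeNorm Φ μ (f : X →ₘ[μ] ℝ) + ε := by rw [ha]; field_simp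

lemma gaugeNorm_eq_zero (f : OrliczSpace Φ μ) (h : ‖f‖ = 0) : f = 0 := by
  rw [OrliczSpace.norm_def] at h
  have hmod : ∀ k : ℝ, 0 < k → orliczModular Φ μ (fun x => (f : X →ₘ[μ] ℝ) x / k) ≤ 1 :=
    fun k hk => modular_le_one_of_gaugeNorm_lt Φ μ f.2 (by rwa [h])
  have key : ∀ δ : ℝ, 0 < δ → μ {x | δ ≤ |(f : X →ₘ[μ] ℝ) x|} = 0 := by
    intro δ hδ
    by_contra hne
    set m := μ {x | δ ≤ |(f : X →ₘ[μ] ℝ) x|} with hm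
    have hlt : m⁻¹ < ∞ := ENNReal.inv_lt_top.2 (pos_iff_ne_zero.2 hne)
    obtain ⟨r, hr, hr0⟩ := ((Φ.tendsto_top.eventually (lt_mem_nhds hlt)).and
      (eventually_gt_atTop 0)).exists
    have h1 := hmod (δ / r) (by positivity)
    have h2 : Φ r * m ≤ 1 := by
      refine le_trans ?_ h1
      calc Φ r * m ≤ Φ r * μ {x | Φ r ≤ Φ ((f : X →ₘ[μ] ℝ) x / (δ / r))} := by
            gcongr
            refine measure_mono fun x hx => ?_
            change Φ r ≤ Φ _
            rw [← Φ.map_abs (_ / _)]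
            refine Φ.mono hr0.le ?_
            rw [abs_div, abs_of_pos (by positivity : 0 < δ / r), le_div_iff₀ (by positivity)]
            rw [mul_div_cancel₀ _ hr0.ne']
            exact hx
        _ ≤ _ := mul_meas_ge_le_lintegral₀ (Φ.measurable.comp_aemeasurable
            ((f : X →ₘ[μ] ℝ).aestronglyMeasurable.aemeasurable.div_const _)) _
    have hmtop : m ≠ ∞ := by
      intro htop
      rw [htop, ENNReal.mul_top ((zero_le).trans_lt hr).ne'] at h2
      exact absurd h2 (by simp)
    have h3 : 1 < Φ r * m := by
      calc (1 : ℝ≥0∞) = m⁻¹ * m := (ENNReal.inv_mul_cancel hne hmtop).symm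
        _ < Φ r * m := ENNReal.mul_lt_mul_left hne hmtop hr
    exact absurd h2 (not_le.2 h3)
  have hae : ∀ᵐ x ∂μ, (f : X →ₘ[μ] ℝ) x = 0 := by
    have hall : ∀ᵐ x ∂μ, ∀ n : ℕ, ¬ (1 / ((n : ℝ) + 1) ≤ |(f : X →ₘ[μ] ℝ) x|) :=
      ae_all_iff.2 fun n => by
        rw [ae_iff]; simpa using key (1 / ((n : ℝ) + 1)) (by positivity)
    filter_upwards [hall] with x hx
    by_contra hne
    obtain ⟨n, hn⟩ := exists_nat_one_div_lt (abs_pos.2 hne)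
    exact hx n hn.le
  apply Subtype.ext
  refine AEEqFun.ext ?_
  filter_upwards [hae, AEEqFun.coeFn_zero (α := X) (β := ℝ) (μ := μ)] with x hx h0
  rw [hx]
  exact h0.symm

lemma gaugeNorm_zero : ‖(0 : OrliczSpace Φ μ)‖ = 0 := by
  refine le_antisymm (le_of_forall_pos_le_add fun ε hε => ?_) (gaugeNorm_nonneg _ _ _)
  rw [zero_add]
  refine gaugeNorm_le Φ μ hε ?_
  rw [orliczModular_congr Φ μ (g := fun _ => 0)
    ((AEEqFun.coeFn_zero (α := X) (β := ℝ) (μ := μ)).mono fun x hx => by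
      change (0 : X →ₘ[μ] ℝ) x / ε = 0
      rw [hx]; simp)]
  simp [orliczModular, Φ.map_zero]

lemma OrliczSpace.core : NormedSpace.Core ℝ (OrliczSpace Φ μ) where
  norm_nonneg f := gaugeNorm_nonneg _ _ _
  norm_smul c f := by
    rcases eq_or_ne c 0 with rfl | hc
    · simp [gaugeNorm_zero]
    refine le_antisymm (gaugeNorm_smul_le Φ μ c hc f) ?_
    have h := gaugeNorm_smul_le Φ μ c⁻¹ (inv_ne_zero hc) (c • f)
    rw [inv_smul_smul₀ hc, abs_inv, inv_mul_eq_div, le_div_iff₀ (abs_pos.2 hc)] at h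
    rw [Real.norm_eq_abs, mul_comm]
    exact h
  norm_triangle := gaugeNorm_add_le Φ μ
  norm_eq_zero_iff f := ⟨gaugeNorm_eq_zero Φ μ f, by rintro rfl; exact gaugeNorm_zero Φ μ⟩

instance OrliczSpace.instNormedAddCommGroup : NormedAddCommGroup (OrliczSpace Φ μ) :=
  NormedAddCommGroup.ofCore (OrliczSpace.core Φ μ)

instance OrliczSpace.instNormedSpace : NormedSpace ℝ (OrliczSpace Φ μ) :=
  NormedSpace.ofCore (OrliczSpace.core Φ μ)

end Space

/-- `φ` is an invertible bimeasurable transformation for which there is `c > 0` with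
`μ(φ⁻¹ A) ≤ c μ(A)` for every measurable `A`. -/
structure IsCompositionSystem (μ : Measure X) (φ : Equiv.Perm X) : Prop where
  measurable : Measurable φ
  measurable_symm : Measurable φ.symm
  bound : ∃ c : ℝ≥0, 0 < c ∧ ∀ A : Set X, MeasurableSet A → μ (φ ⁻¹' A) ≤ c * μ A

namespace IsCompositionSystem

variable {μ : Measure X} {φ : Equiv.Perm X}

lemma map_le (h : IsCompositionSystem μ φ) : ∃ c : ℝ≥0, 1 ≤ c ∧ μ.map φ ≤ (c : ℝ≥0∞) • μ := by
  obtain ⟨c, -, hc⟩ := h.bound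
  refine ⟨max c 1, le_max_right _ _, Measure.le_iff.2 fun A hA => ?_⟩
  rw [Measure.map_apply h.measurable hA, Measure.smul_apply, smul_eq_mul]
  refine (hc A hA).trans ?_
  gcongr
  exact le_max_left _ _

lemma quasi (h : IsCompositionSystem μ φ) : Measure.QuasiMeasurePreserving φ μ μ := by
  obtain ⟨c, -, hc⟩ := h.map_le
  exact ⟨h.measurable, (Measure.absolutelyContinuous_of_le hc).trans
    (Measure.smul_absolutelyContinuous)⟩

lemma modular_comp_le (h : IsCompositionSystem μ φ) (Φ : YoungFunction) :
    ∃ c : ℝ≥0, 1 ≤ c ∧ ∀ (f : X →ₘ[μ] ℝ) (a : ℝ),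
      orliczModular Φ μ (fun x => a * (f.compQuasiMeasurePreserving φ h.quasi) x) ≤
        c * orliczModular Φ μ (fun x => a * f x) := by
  obtain ⟨c, hc1, hc⟩ := h.map_le
  refine ⟨c, hc1, fun f a => ?_⟩
  rw [orliczModular_congr Φ μ (g := fun x => a * f (φ x))
    ((AEEqFun.coeFn_compQuasiMeasurePreserving f h.quasi).mono fun x hx => by simp [hx])]
  unfold orliczModular
  have hm : Measurable fun x => Φ (a * f x) :=
    Φ.measurable.comp (f.stronglyMeasurable.measurable.const_mul a)
  calc ∫⁻ x, Φ (a * f (φ x)) ∂μ = ∫⁻ x, Φ (a * f x) ∂(μ.map φ) :=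
        (lintegral_map hm h.measurable).symm
    _ ≤ ∫⁻ x, Φ (a * f x) ∂((c : ℝ≥0∞) • μ) := lintegral_mono' hc le_rfl
    _ = c * ∫⁻ x, Φ (a * f x) ∂μ := by rw [lintegral_smul_measure, smul_eq_mul]

/-- Composition with `φ` as a linear map of `L^Φ(μ)`. -/
def compLinear (h : IsCompositionSystem μ φ) (Φ : YoungFunction) :
    OrliczSpace Φ μ →ₗ[ℝ] OrliczSpace Φ μ where
  toFun f := ⟨(f : X →ₘ[μ] ℝ).compQuasiMeasurePreserving φ h.quasi, by
    obtain ⟨c, -, hc⟩ := h.modular_comp_le Φ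
    obtain ⟨k, hk, hkf⟩ := f.2
    exact ⟨k, hk, (hc f k).trans_lt (ENNReal.mul_lt_top ENNReal.coe_lt_top hkf)⟩⟩
  map_add' f g := by
    have key : ∀ a b : X →ₘ[μ] ℝ, (a + b).compQuasiMeasurePreserving φ h.quasi =
        a.compQuasiMeasurePreserving φ h.quasi + b.compQuasiMeasurePreserving φ h.quasi :=
      fun a b => AEEqFun.induction_on₂ a b fun _ _ _ _ => rfl
    exact Subtype.ext (key f g)
  map_smul' r f := by
    have key : ∀ a : X →ₘ[μ] ℝ, (r • a).compQuasiMeasurePreserving φ h.quasi =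
        r • a.compQuasiMeasurePreserving φ h.quasi :=
      fun a => AEEqFun.induction_on a fun _ _ => rfl
    exact Subtype.ext (key f)

lemma compLinear_bound (h : IsCompositionSystem μ φ) (Φ : YoungFunction) :
    ∃ c : ℝ, ∀ f : OrliczSpace Φ μ, ‖h.compLinear Φ f‖ ≤ c * ‖f‖ := by
  obtain ⟨c, hc1, hc⟩ := h.modular_comp_le Φ
  have hc0 : (0 : ℝ) < c := by exact_mod_cast zero_lt_one.trans_le hc1
  refine ⟨c, fun f => le_of_forall_pos_le_add fun ε hε => ?_⟩
  have hf0 := gaugeNorm_nonneg Φ μ (f : X →ₘ[μ] ℝ)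
  set a := gaugeNorm Φ μ (f : X →ₘ[μ] ℝ) + ε / c with ha
  have ha0 : 0 < a := by positivity
  have h1 := modular_le_one_of_gaugeNorm_lt Φ μ (a := a) f.2 (by linarith [div_pos hε hc0])
  have hle : gaugeNorm Φ μ ((h.compLinear Φ f : OrliczSpace Φ μ) : X →ₘ[μ] ℝ) ≤ c * a := by
    refine gaugeNorm_le Φ μ (by positivity) ?_
    have e : (fun x => ((h.compLinear Φ f : OrliczSpace Φ μ) : X →ₘ[μ] ℝ) x / (c * a)) =
        fun x => ((c⁻¹ : ℝ≥0) : ℝ) *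
          (a⁻¹ * ((f : X →ₘ[μ] ℝ).compQuasiMeasurePreserving φ h.quasi) x) := by
      funext x
      change (((f : X →ₘ[μ] ℝ).compQuasiMeasurePreserving φ h.quasi) x) / (c * a) = _
      push_cast
      field_simp
    rw [e]
    refine (orliczModular_smul_le Φ μ _ (inv_le_one_of_one_le₀ hc1) _).trans ?_
    calc _ ≤ ((c⁻¹ : ℝ≥0) : ℝ≥0∞) *
          (c * orliczModular Φ μ (fun x => a⁻¹ * (f : X →ₘ[μ] ℝ) x)) := by
          gcongr; exact hc _ _
      _ = orliczModular Φ μ (fun x => (f : X →ₘ[μ] ℝ) x / a) := by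
          rw [← mul_assoc, ← ENNReal.coe_mul, inv_mul_cancel₀ (zero_lt_one.trans_le hc1).ne',
            ENNReal.coe_one, one_mul]
          simp only [div_eq_inv_mul]
      _ ≤ 1 := h1
  calc _ ≤ (c : ℝ) * a := hle
    _ = c * gaugeNorm Φ μ (f : X →ₘ[μ] ℝ) + ε := by rw [ha]; field_simp

/-- The composition operator `C_φ f = f ∘ φ`, a bounded linear operator on `L^Φ(μ)`. -/
def compositionOperator (h : IsCompositionSystem μ φ) (Φ : YoungFunction) :
    OrliczSpace Φ μ →L[ℝ] OrliczSpace Φ μ :=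
  (h.compLinear Φ).mkContinuousOfExistsBound (h.compLinear_bound Φ)

lemma compositionOperator_ae (h : IsCompositionSystem μ φ) (Φ : YoungFunction)
    (f : OrliczSpace Φ μ) :
    ((h.compositionOperator Φ f : OrliczSpace Φ μ) : X →ₘ[μ] ℝ) =ᵐ[μ]
      (f : X →ₘ[μ] ℝ) ∘ φ :=
  AEEqFun.coeFn_compQuasiMeasurePreserving _ h.quasi

end IsCompositionSystem

/-- The system is dissipative, generated by `W`: `W` is measurable, `0 < μ(W) < ∞`, and `X` is the
disjoint union of the sets `φᵏ(W)`, `k ∈ ℤ`. -/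
structure IsDissipative (μ : Measure X) (φ : Equiv.Perm X) (W : Set X) : Prop where
  measurableSet : MeasurableSet W
  pos : 0 < μ W
  lt_top : μ W < ∞
  iUnion_eq : ⋃ k : ℤ, (φ ^ k : Equiv.Perm X) '' W = Set.univ
  disjoint : Pairwise fun j k : ℤ =>
    Disjoint ((φ ^ j : Equiv.Perm X) '' W) ((φ ^ k : Equiv.Perm X) '' W)

/-- The gauge norm `N_Φ(C_φᵏ χ_F)` of `C_φᵏ χ_F = χ_F ∘ φᵏ`, `k ∈ ℤ`. -/
def indicatorNorm (Φ : YoungFunction) (μ : Measure X) (φ : Equiv.Perm X) (k : ℤ) (F : Set X) : ℝ :=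
  gaugeNorm Φ μ (fun x => F.indicator (fun _ => (1 : ℝ)) ((φ ^ k : Equiv.Perm X) x))

/-- Bounded distortion on `W`, with respect to the gauge norm. The quotients are meant for sets
`F ⊆ W` of positive measure. -/
def HasBoundedDistortion (Φ : YoungFunction) (μ : Measure X) (φ : Equiv.Perm X) (W : Set X) :
    Prop :=
  ∃ K : ℝ, 0 < K ∧ ∀ (k : ℤ) (F : Set X), MeasurableSet F → F ⊆ W → 0 < μ F →
    1 / K * (indicatorNorm Φ μ φ k W / indicatorNorm Φ μ φ 0 W) ≤
        indicatorNorm Φ μ φ k F / indicatorNorm Φ μ φ 0 F ∧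
      indicatorNorm Φ μ φ k F / indicatorNorm Φ μ φ 0 F ≤
        K * (indicatorNorm Φ μ φ k W / indicatorNorm Φ μ φ 0 W)

/-- The number `Φ⁻¹(1 / μ(φᵏ(W)))`. -/
def orbitInverse (Φ : YoungFunction) (μ : Measure X) (φ : Equiv.Perm X) (W : Set X) (k : ℤ) :
    ℝ≥0∞ :=
  Φ.inverse (1 / μ ((φ ^ k : Equiv.Perm X) '' W))

/-- A bounded operator `T` on a normed space is strongly structurally stable if it is invertible
and for every `ε > 0` there is `δ > 0` such that for every Lipschitz map `α` with `‖α‖_∞ ≤ δ` and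
Lipschitz constant at most `δ` there is a homeomorphism `h` of the space with
`h ∘ T = (T + α) ∘ h` and `‖h - I‖_∞ ≤ ε`. -/
def IsStronglyStructurallyStable {E : Type*} [NormedAddCommGroup E] [NormedSpace ℝ E]
    (T : E →L[ℝ] E) : Prop :=
  IsUnit T ∧ ∀ ε : ℝ, 0 < ε → ∃ δ : ℝ≥0, 0 < δ ∧ ∀ α : E → E,
    LipschitzWith δ α → (∀ x, ‖α x‖ ≤ δ) →
      ∃ h : E ≃ₜ E, (∀ x, h (T x) = T (h x) + α (h x)) ∧ ∀ x, ‖h x - x‖ ≤ ε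

end

/-! ### Structural stability from a summable Green kernel -/

section StructuralStability

/-! Write `w k` for the gauge norm of the indicator of `φᵏ(W)`. Then `u_k = 1 / w k`
(`inverse_eq_indicatorGauge`), so each rate condition says that gauges shrink by any prescribed
factor after enough steps, in one direction on all of `ℤ` or on each half line. Composition with `φ`
moves the level `k` to the level `k - 1`, so the expected conclusion is that `C_φ` contracts
functions on levels where `w` decreases to the left, and its inverse those where `w` decreases to
the right.

Bounded distortion transfers the decay of `w` from `W` to all its subsets, and convexity of `Φ`
converts gauges into measures: some power of `φ` contracts `μ` on the relevant levels
(`exists_measure_preimage_le`). To pass from measures to norms one needs a doubling bound for `Φ`.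
It comes from the system itself: `w` decays geometrically, while the measures of levels at a fixed
distance are comparable, which bounds `Φ (2 * v)` by a multiple of `Φ v` (`doubling_of_levelGauge`).
The two facts give `exists_contraction`.

Hence `C_φ` is a contraction, an expansion, or generalized hyperbolic: the functions on a set `S`
with `φ⁻¹(S) ⊆ S` are contracted by a power of `C_φ`, those on the complement by a power of its
inverse. Such an operator `T` has a summable kernel `A` with `A (k - 1) - T A k = δ_{k0}`. Summing
`A` along orbits solves `g ∘ S - T ∘ g = β`; a fixed point argument then produces `h = id + g`, and
the same kernel along the orbits of `T + α` gives its inverse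
(`isStronglyStructurallyStable_of_greenKernel`). -/

lemma Homeomorph.semiconj_zpow {Y : Type*} [TopologicalSpace Y] {h : Y → Y} {S₁ S₂ : Y ≃ₜ Y}
    (hS : ∀ x, h (S₁ x) = S₂ (h x)) (k : ℤ) (x : Y) :
    h ((S₁ ^ k : Y ≃ₜ Y) x) = (S₂ ^ k : Y ≃ₜ Y) (h x) := by
  have hinv : ∀ x, h (S₁⁻¹ x) = S₂⁻¹ (h x) := fun x => by
    have h1 := hS (S₁⁻¹ x)
    have h2 : S₁ (S₁⁻¹ x) = x := S₁.apply_symm_apply x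
    rw [h2] at h1
    rw [h1]
    exact (S₂.symm_apply_apply _).symm
  induction k generalizing x with
  | zero => rfl
  | succ n ih =>
    rw [zpow_add_one, zpow_add_one]
    change h ((S₁ ^ (n : ℤ) : Y ≃ₜ Y) (S₁ x)) = (S₂ ^ (n : ℤ) : Y ≃ₜ Y) (S₂ (h x))
    rw [ih, hS]
  | pred n ih =>
    rw [zpow_sub_one, zpow_sub_one]
    change h ((S₁ ^ (-n : ℤ) : Y ≃ₜ Y) (S₁⁻¹ x)) = (S₂ ^ (-n : ℤ) : Y ≃ₜ Y) (S₂⁻¹ (h x))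
    rw [ih, hinv]

variable {E : Type*} [NormedAddCommGroup E] [NormedSpace ℝ E]

/-- The sum of a two-sided family of operators against a map along the orbits of `S`. -/
noncomputable def orbitSum (A : ℤ → E →L[ℝ] E) (S : E ≃ₜ E) (β : E → E) (x : E) : E :=
  ∑' k, A k (β ((S ^ k : E ≃ₜ E) x))

variable {A : ℤ → E →L[ℝ] E} {S : E ≃ₜ E} {β : E → E} {C : ℝ}

lemma orbitSum_term_le (hβ : ∀ x, ‖β x‖ ≤ C) (k : ℤ) (x : E) :
    ‖A k (β ((S ^ k : E ≃ₜ E) x))‖ ≤ ‖A k‖ * C :=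
  (A k).le_opNorm_of_le (hβ _)

/-- A semiconjugacy carries orbits to orbits. This is used both for the conjugacy and for its
candidate inverse. -/
lemma orbitSum_comp {h : E → E} {S₁ S₂ : E ≃ₜ E} (hS : ∀ x, h (S₁ x) = S₂ (h x)) (x : E) :
    orbitSum A S₁ (fun y => β (h y)) x = orbitSum A S₂ β (h x) := by
  simp only [orbitSum, Homeomorph.semiconj_zpow hS]

lemma norm_orbitSum_le (hA : Summable fun k => ‖A k‖) (hβ : ∀ x, ‖β x‖ ≤ C) (x : E) :
    ‖orbitSum A S β x‖ ≤ (∑' k, ‖A k‖) * C :=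
  tsum_of_norm_bounded (hA.hasSum.mul_right C) fun k => orbitSum_term_le hβ k x

variable [CompleteSpace E]

lemma orbitSum_summable (hA : Summable fun k => ‖A k‖) (hβ : ∀ x, ‖β x‖ ≤ C) (x : E) :
    Summable fun k => A k (β ((S ^ k : E ≃ₜ E) x)) :=
  Summable.of_norm_bounded (hA.mul_right C) fun k => orbitSum_term_le hβ k x

lemma continuous_orbitSum (hA : Summable fun k => ‖A k‖) (hβ : ∀ x, ‖β x‖ ≤ C)
    (hc : Continuous β) : Continuous (orbitSum A S β) :=
  continuous_tsum (fun k => (A k).continuous.comp (hc.comp (S ^ k : E ≃ₜ E).continuous))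
    (hA.mul_right C) fun k x => orbitSum_term_le hβ k x

lemma orbitSum_sub {γ : E → E} {D : ℝ} (hA : Summable fun k => ‖A k‖) (hβ : ∀ x, ‖β x‖ ≤ C)
    (hγ : ∀ x, ‖γ x‖ ≤ D) (x : E) :
    orbitSum A S β x - orbitSum A S γ x = orbitSum A S (fun y => β y - γ y) x := by
  simp only [orbitSum, map_sub]
  exact ((orbitSum_summable hA hβ x).tsum_sub (orbitSum_summable hA hγ x)).symm

/-- After a shift of the index, the left side is the sum of `(A (k - 1) - T A k) β(Sᵏ x)`, and the
kernel identity leaves only `k = 0`. -/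
lemma orbitSum_apply (T : E →L[ℝ] E) (hA : Summable fun k => ‖A k‖)
    (hT : ∀ k, A (k - 1) - T.comp (A k) = if k = 0 then 1 else 0) (hβ : ∀ x, ‖β x‖ ≤ C) (x : E) :
    orbitSum A S β (S x) - T (orbitSum A S β x) = β x := by
  have h1 : orbitSum A S β (S x) = ∑' k, A (k - 1) (β ((S ^ k : E ≃ₜ E) x)) := by
    rw [orbitSum, ← (Equiv.subRight (1 : ℤ)).tsum_eq]
    refine tsum_congr fun k => ?_
    change A (k - 1) (β ((S ^ (k - 1) : E ≃ₜ E) (S x))) = _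
    congr 2
    change (S ^ (k - 1) * S) x = _
    rw [← zpow_add_one, sub_add_cancel]
  have s1 : Summable fun k => A (k - 1) (β ((S ^ k : E ≃ₜ E) x)) :=
    Summable.of_norm_bounded (g := fun k => ‖A (k - 1)‖ * C)
      (((Equiv.subRight (1 : ℤ)).summable_iff.2 hA).mul_right C)
      fun k => (A (k - 1)).le_opNorm_of_le (hβ _)
  have s2 := orbitSum_summable (S := S) hA hβ x
  have s3 : Summable fun k => T (A k (β ((S ^ k : E ≃ₜ E) x))) := s2.map T T.continuous
  rw [h1, orbitSum, T.map_tsum s2, ← s1.tsum_sub s3, tsum_eq_single 0]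
  · have := DFunLike.congr_fun (hT 0) (β ((S ^ (0 : ℤ) : E ≃ₜ E) x))
    simpa using this
  · intro k hk
    have := DFunLike.congr_fun (hT k) (β ((S ^ k : E ≃ₜ E) x))
    simpa [hk] using this

/-- A perturbation of Lipschitz constant below `‖T⁻¹‖⁻¹` keeps `T` a global homeomorphism; `(N +
1)⁻¹` is such a constant, and is positive even on the trivial space. -/
lemma exists_homeomorph_of_lipschitz_perturbation (T : E ≃L[ℝ] E) :
    ∃ δ₀ : ℝ≥0, 0 < δ₀ ∧ ∀ α : E → E, LipschitzWith δ₀ α →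
      ∃ S : E ≃ₜ E, ∀ x, S x = T x + α x := by
  set N := ‖(T.symm : E →L[ℝ] E)‖₊ with hN
  refine ⟨(N + 1)⁻¹, by positivity, fun α hα => ?_⟩
  have happ : ApproximatesLinearOn (fun x => T x + α x) (T : E →L[ℝ] E) Set.univ (N + 1)⁻¹ := by
    intro x _ y _
    have e : T x + α x - (T y + α y) - (T : E →L[ℝ] E) (x - y) = α x - α y := by
      rw [map_sub]
      simp only [ContinuousLinearEquiv.coe_coe]
      abel
    rw [e]
    exact hα.norm_sub_le x y
  have hc : Subsingleton E ∨ (N + 1)⁻¹ < N⁻¹ := by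
    rcases subsingleton_or_nontrivial E with h | h
    · exact Or.inl h
    · right
      have : 0 < N := T.nnnorm_symm_pos
      exact inv_strictAnti₀ this (lt_add_one N)
  exact ⟨happ.toHomeomorph _ hc, fun x => rfl⟩

/-- A bounded operator with a summable two-sided Green kernel is strongly structurally stable. -/
theorem isStronglyStructurallyStable_of_greenKernel (T : E ≃L[ℝ] E)
    (A : ℤ → E →L[ℝ] E) (hA : Summable fun k => ‖A k‖)
    (hT : ∀ k, A (k - 1) - (T : E →L[ℝ] E).comp (A k) = if k = 0 then 1 else 0) :
    IsStronglyStructurallyStable (T : E →L[ℝ] E) := by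
  refine ⟨ContinuousLinearMap.isUnit_iff_bijective.2 T.bijective, fun ε hε => ?_⟩
  obtain ⟨δ₀, hδ₀, hS⟩ := exists_homeomorph_of_lipschitz_perturbation T
  set ρ : ℝ := ∑' k, ‖A k‖ with hρ
  have hρ0 : 0 ≤ ρ := tsum_nonneg fun _ => norm_nonneg _
  -- The three bounds serve invertibility of `T + α`, closeness of `h` to the identity, and
  -- contraction of the fixed point map.
  obtain ⟨δ, hδ, hδδ₀, hδε, hδ2⟩ : ∃ δ : ℝ≥0, 0 < δ ∧ δ ≤ δ₀ ∧ ρ * δ ≤ ε ∧ ρ * δ ≤ 1 / 2 := by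
    have hm : 0 < min (δ₀ : ℝ) (min ε (1 / 2) / (ρ + 1)) := by positivity
    refine ⟨⟨_, hm.le⟩, hm, NNReal.coe_le_coe.1 (min_le_left (δ₀ : ℝ) _), ?_, ?_⟩
    all_goals
      change ρ * min (δ₀ : ℝ) (min ε (1 / 2) / (ρ + 1)) ≤ _
      calc ρ * min (δ₀ : ℝ) (min ε (1 / 2) / (ρ + 1)) ≤ (ρ + 1) * (min ε (1 / 2) / (ρ + 1)) :=
            mul_le_mul (by linarith) (min_le_right _ _) hm.le (by linarith)
        _ = min ε (1 / 2) := by field_simp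
        _ ≤ _ := by simp
  refine ⟨δ, hδ, fun α hα hαb => ?_⟩
  obtain ⟨S, hS⟩ := hS α (hα.weaken hδδ₀)
  have hαc : Continuous α := hα.continuous
  have hcont : ∀ g : BoundedContinuousFunction E E, Continuous fun x => α (x + g x) :=
    fun g => hαc.comp (continuous_id.add g.continuous)
  let T' : E ≃ₜ E := T.toHomeomorph
  have hT' : ∀ x, T' x = T x := fun x => rfl
  -- A fixed point `g` satisfies `g (T x) - T (g x) = α (x + g x)`, which is the conjugacy equation
  -- for `id + g`.
  let F : BoundedContinuousFunction E E → BoundedContinuousFunction E E := fun g =>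
    BoundedContinuousFunction.ofNormedAddCommGroup (orbitSum A T' fun x => α (x + g x))
      (continuous_orbitSum hA (fun x => hαb _) (hcont g)) (ρ * δ)
      (norm_orbitSum_le hA fun x => hαb _)
  have hF : ∀ g x, F g x = orbitSum A T' (fun x => α (x + g x)) x := fun g x => rfl
  have hFc : ContractingWith (1 / 2) F := by
    refine ⟨by rw [← NNReal.coe_lt_coe]; norm_num, LipschitzWith.of_dist_le_mul fun g₁ g₂ => ?_⟩
    rw [BoundedContinuousFunction.dist_le (by positivity)]
    intro x
    rw [dist_eq_norm, hF, hF, orbitSum_sub hA (fun x => hαb _) (fun x => hαb _)]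
    calc _ ≤ ρ * (δ * dist g₁ g₂) := by
          refine norm_orbitSum_le hA (fun y => ?_) x
          refine (hα.norm_sub_le _ _).trans ?_
          rw [add_sub_add_left_eq_sub, ← dist_eq_norm]
          gcongr
          exact BoundedContinuousFunction.dist_coe_le_dist y
      _ = (ρ * δ) * dist g₁ g₂ := by ring
      _ ≤ _ := by gcongr; exact hδ2.trans (by norm_num)
  set g := ContractingWith.fixedPoint F hFc with hg
  have hgF : ∀ x, g x = orbitSum A T' (fun x => α (x + g x)) x := fun x => by
    conv_lhs => rw [hg, ← ContractingWith.fixedPoint_isFixedPt hFc]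
    rfl
  set h : E → E := fun x => x + g x with hh
  have hconj : ∀ x, h (T' x) = S (h x) := fun x => by
    have := orbitSum_apply (S := T') (T : E →L[ℝ] E) hA hT (fun x => hαb (h x)) x
    simp only [hh, hS, hgF (T' x)] at this ⊢
    rw [sub_eq_iff_eq_add.1 this, ← hgF x, map_add, hT']
    simp only [ContinuousLinearEquiv.coe_coe]
    abel
  -- The same kernel, summed along the orbits of `S = T + α`, semiconjugates back from `S` to `T`.
  set h' : E → E := fun y => y - orbitSum A S α y with hh'
  have hgS : ∀ x, g x = orbitSum A S α (h x) := fun x => by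
    rw [hgF]; exact orbitSum_comp (h := h) hconj x
  have hconj' : ∀ y, h' (S y) = T' (h' y) := fun y => by
    have := orbitSum_apply (S := S) (T : E →L[ℝ] E) hA hT hαb y
    simp only [hh', hT']
    rw [sub_eq_iff_eq_add.1 this, map_sub, hS]
    simp only [ContinuousLinearEquiv.coe_coe]
    abel
  have left : ∀ x, h' (h x) = x := fun x => by
    simp only [hh', ← hgS]; simp [hh]
  -- The error of the right inverse reproduces itself through `α`. It is bounded, and each pass
  -- costs a factor `ρ * δ ≤ 1 / 2`, so it vanishes.
  have key : ∀ y, h (h' y) - y = orbitSum A S (fun z => α (h (h' z)) - α z) y := fun y => by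
    rw [← orbitSum_sub hA (fun z => hαb _) hαb]
    have e : g (h' y) = orbitSum A S (fun z => α (h (h' z))) y := by
      rw [hgF]; exact (orbitSum_comp (β := fun z => α (h z)) (h := h') hconj' y).symm
    rw [← e]
    simp only [hh, hh']
    abel
  have bound : ∀ n : ℕ, ∀ y, ‖h (h' y) - y‖ ≤ (1 / 2) ^ n * (ρ * (δ + δ)) := fun n => by
    induction n with
    | zero =>
      intro y
      rw [key, pow_zero, one_mul]
      exact norm_orbitSum_le hA (fun z => (norm_sub_le _ _).trans
        (add_le_add (hαb _) (hαb _))) y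
    | succ n ih =>
      intro y
      rw [key]
      calc _ ≤ ρ * (δ * ((1 / 2) ^ n * (ρ * (δ + δ)))) :=
            norm_orbitSum_le hA (fun z => (hα.norm_sub_le _ _).trans (by gcongr; exact ih z)) y
        _ = (ρ * δ) * ((1 / 2) ^ n * (ρ * (δ + δ))) := by ring
        _ ≤ (1 / 2) * ((1 / 2) ^ n * (ρ * (δ + δ))) := by gcongr
        _ = _ := by ring
  have right : ∀ y, h (h' y) = y := fun y => by
    have hlim : Tendsto (fun n : ℕ => (1 / 2 : ℝ) ^ n * (ρ * (δ + δ))) atTop (𝓝 0) := by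
      simpa using (tendsto_pow_atTop_nhds_zero_of_lt_one (by norm_num : (0 : ℝ) ≤ 1 / 2)
        (by norm_num)).mul_const (ρ * (δ + δ))
    have := ge_of_tendsto' hlim fun n => bound n y
    exact sub_eq_zero.1 (norm_le_zero_iff.1 this)
  refine ⟨⟨⟨h, h', left, right⟩, continuous_id.add g.continuous,
    continuous_id.sub (continuous_orbitSum hA hαb hαc)⟩, fun x => ?_, fun x => ?_⟩
  · change h (T' x) = T (h x) + α (h x)
    rw [hconj, hS]
  · change ‖x + g x - x‖ ≤ ε
    rw [add_sub_cancel_left, hgF]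
    exact (norm_orbitSum_le hA (fun x => hαb _) x).trans hδε

end StructuralStability

/-! ### Completeness of the Orlicz space -/

lemma YoungFunction.continuous (Φ : YoungFunction) (h : ∀ x, Φ x ≠ ∞) : Continuous Φ.toFun := by
  have hconv : ConvexOn ℝ Set.univ fun x => (Φ x).toReal := by
    refine ⟨convex_univ, fun x _ y _ a b ha hb hab => ?_⟩
    lift a to ℝ≥0 using ha
    lift b to ℝ≥0 using hb
    have hc := Φ.convex.2 (Set.mem_univ x) (Set.mem_univ y) (zero_le : 0 ≤ a) (zero_le : 0 ≤ b)
      (by exact_mod_cast hab)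
    simp only [ENNReal.smul_def, NNReal.smul_def] at hc
    have hx : (a : ℝ≥0∞) * Φ x ≠ ∞ := ENNReal.mul_ne_top ENNReal.coe_ne_top (h x)
    have hy : (b : ℝ≥0∞) * Φ y ≠ ∞ := ENNReal.mul_ne_top ENNReal.coe_ne_top (h y)
    have := ENNReal.toReal_mono (ENNReal.add_ne_top.2 ⟨hx, hy⟩) hc
    rw [ENNReal.toReal_add hx hy, ENNReal.toReal_mul, ENNReal.toReal_mul] at this
    simpa using this
  have hc : Continuous fun x => (Φ x).toReal :=
    continuousOn_univ.1 (hconv.continuousOn isOpen_univ)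
  have e : Φ.toFun = fun x => ENNReal.ofReal (Φ x).toReal :=
    funext fun x => (ENNReal.ofReal_toReal (h x)).symm
  rw [e]
  exact ENNReal.continuous_ofReal.comp hc

section Completeness

variable {X : Type*} [MeasurableSpace X] (Φ : YoungFunction) (μ : Measure X)

/-- Fatou's lemma; finiteness of `Φ` makes it continuous, which identifies the pointwise lower
limit. -/
lemma orliczModular_le_of_tendsto (hΦ : ∀ x, Φ x ≠ ∞) {F : ℕ → X → ℝ} {f : X → ℝ} {C : ℝ≥0∞}
    (hF : ∀ n, AEMeasurable (F n) μ)
    (hlim : ∀ᵐ x ∂μ, Tendsto (fun n => F n x) atTop (𝓝 (f x)))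
    (hC : ∀ᶠ n in atTop, orliczModular Φ μ (F n) ≤ C) : orliczModular Φ μ f ≤ C := by
  calc orliczModular Φ μ f = ∫⁻ x, liminf (fun n => Φ (F n x)) atTop ∂μ :=
        lintegral_congr_ae (hlim.mono fun x hx =>
          (((Φ.continuous hΦ).tendsto _).comp hx).liminf_eq.symm)
    _ ≤ liminf (fun n => ∫⁻ x, Φ (F n x) ∂μ) atTop :=
        lintegral_liminf_le' fun n => Φ.measurable.comp_aemeasurable (hF n)
    _ ≤ C := liminf_le_of_le (by isBoundedDefault) fun b hb => by
        obtain ⟨n, h1, h2⟩ := (hb.and hC).exists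
        exact h1.trans h2

lemma OrliczSpace.coeFn_add (f g : OrliczSpace Φ μ) :
    ((f + g : OrliczSpace Φ μ) : X →ₘ[μ] ℝ) =ᵐ[μ] fun x => (f : X →ₘ[μ] ℝ) x + (g : X →ₘ[μ] ℝ) x :=
  AEEqFun.coeFn_add (f : X →ₘ[μ] ℝ) (g : X →ₘ[μ] ℝ)

lemma OrliczSpace.coeFn_sub (f g : OrliczSpace Φ μ) :
    ((f - g : OrliczSpace Φ μ) : X →ₘ[μ] ℝ) =ᵐ[μ] fun x => (f : X →ₘ[μ] ℝ) x - (g : X →ₘ[μ] ℝ) x :=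
  AEEqFun.coeFn_sub (f : X →ₘ[μ] ℝ) (g : X →ₘ[μ] ℝ)

lemma OrliczSpace.coeFn_zero : ((0 : OrliczSpace Φ μ) : X →ₘ[μ] ℝ) =ᵐ[μ] fun _ => 0 :=
  AEEqFun.coeFn_zero

lemma OrliczSpace.coeFn_sum (u : ℕ → OrliczSpace Φ μ) (n : ℕ) :
    ((∑ i ∈ Finset.range n, u i : OrliczSpace Φ μ) : X →ₘ[μ] ℝ) =ᵐ[μ]
      fun x => ∑ i ∈ Finset.range n, (u i : X →ₘ[μ] ℝ) x := by
  induction n with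
  | zero => simpa using OrliczSpace.coeFn_zero Φ μ
  | succ n ih =>
    simp only [Finset.sum_range_succ]
    filter_upwards [ih, OrliczSpace.coeFn_add Φ μ (∑ i ∈ Finset.range n, u i) (u n)] with x h1 h2
    rw [h2, h1]

variable {Φ μ} in
/-- The class of `|f|`. -/
noncomputable def OrliczSpace.absFun (f : OrliczSpace Φ μ) : OrliczSpace Φ μ :=
  ⟨|(f : X →ₘ[μ] ℝ)|, by
    obtain ⟨k, hk, hf⟩ := f.2
    refine ⟨k, hk, lt_of_eq_of_lt ?_ hf⟩
    refine lintegral_congr_ae ((AEEqFun.coeFn_abs (f : X →ₘ[μ] ℝ)).mono fun x hx => ?_)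
    simp only [hx]
    rw [← Φ.map_abs, ← Φ.map_abs (k * (f : X →ₘ[μ] ℝ) x), abs_mul, abs_abs, ← abs_mul]⟩

lemma OrliczSpace.coeFn_absFun (f : OrliczSpace Φ μ) :
    (OrliczSpace.absFun f : X →ₘ[μ] ℝ) =ᵐ[μ] fun x => |(f : X →ₘ[μ] ℝ) x| :=
  AEEqFun.coeFn_abs (f : X →ₘ[μ] ℝ)

variable {Φ μ} in
lemma OrliczSpace.norm_le_of_modular {f : OrliczSpace Φ μ} {a : ℝ} (ha : 0 < a)
    (h : orliczModular Φ μ (fun x => (f : X →ₘ[μ] ℝ) x / a) ≤ 1) : ‖f‖ ≤ a :=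
  gaugeNorm_le Φ μ ha h

variable {Φ μ} in
lemma OrliczSpace.modular_le_one {f : OrliczSpace Φ μ} {a : ℝ} (h : ‖f‖ < a) :
    orliczModular Φ μ (fun x => (f : X →ₘ[μ] ℝ) x / a) ≤ 1 :=
  modular_le_one_of_gaugeNorm_lt Φ μ f.2 h

variable {Φ μ} in
/-- A bounded positive transfer of modulars gives a norm bound. -/
lemma OrliczSpace.norm_le_mul_of_modular {f g : OrliczSpace Φ μ} {t : ℝ} (ht : 0 < t)
    (h : ∀ a : ℝ, 0 < a → orliczModular Φ μ (fun x => (f : X →ₘ[μ] ℝ) x / a) ≤ 1 →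
      orliczModular Φ μ (fun x => (g : X →ₘ[μ] ℝ) x / (t * a)) ≤ 1) : ‖g‖ ≤ t * ‖f‖ := by
  refine le_of_forall_pos_le_add fun ε hε => ?_
  have ha : ‖f‖ < ‖f‖ + ε / t := by linarith [div_pos hε ht]
  have ha0 : 0 < ‖f‖ + ε / t := (norm_nonneg _).trans_lt ha
  have := norm_le_of_modular (by positivity) (h _ ha0 (modular_le_one ha))
  calc ‖g‖ ≤ t * (‖f‖ + ε / t) := this
    _ = _ := by field_simp

lemma OrliczSpace.norm_absFun_le (f : OrliczSpace Φ μ) : ‖OrliczSpace.absFun f‖ ≤ ‖f‖ := by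
  have := norm_le_mul_of_modular (f := f) (g := OrliczSpace.absFun f) one_pos fun a _ h => by
    refine le_of_eq_of_le (lintegral_congr_ae ?_) h
    filter_upwards [OrliczSpace.coeFn_absFun Φ μ f] with x hx
    rw [hx, one_mul, ← Φ.map_abs, ← Φ.map_abs (_ / a), abs_div, abs_abs, ← abs_div]
  simpa using this

/-- By monotone convergence the supremum of `Φ (G n / a)` has integral at most one, so it is finite
almost everywhere; since `Φ` tends to infinity, the partial sums `G n` of absolute values are then
bounded. -/
lemma OrliczSpace.ae_summable (u : ℕ → OrliczSpace Φ μ) (hu : Summable fun n => ‖u n‖) :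
    ∀ᵐ x ∂μ, Summable fun n => |(u n : X →ₘ[μ] ℝ) x| := by
  set a : ℝ := ∑' n, ‖u n‖ + 1 with ha
  have ha0 : 0 < a := by have : 0 ≤ ∑' n, ‖u n‖ := tsum_nonneg fun _ => norm_nonneg _
                         positivity
  set G : ℕ → X → ℝ := fun n x => ∑ i ∈ Finset.range n, |(u i : X →ₘ[μ] ℝ) x| with hG
  have hGm : ∀ n, Measurable (G n) := fun n =>
    Finset.measurable_sum _ fun i _ => ((u i : X →ₘ[μ] ℝ).stronglyMeasurable.measurable).abs
  have hG0 : ∀ n x, 0 ≤ G n x := fun n x => Finset.sum_nonneg fun _ _ => abs_nonneg _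
  have hGmono : ∀ x, Monotone fun n => G n x := fun x =>
    monotone_nat_of_le_succ fun n => by
      simp only [hG, Finset.sum_range_succ]; linarith [abs_nonneg ((u n : X →ₘ[μ] ℝ) x)]
  have h1 : ∀ n, ∫⁻ x, Φ (G n x / a) ∂μ ≤ 1 := fun n => by
    have hn : ‖∑ i ∈ Finset.range n, OrliczSpace.absFun (u i)‖ < a :=
      calc _ ≤ ∑ i ∈ Finset.range n, ‖OrliczSpace.absFun (u i)‖ := norm_sum_le _ _
        _ ≤ ∑ i ∈ Finset.range n, ‖u i‖ :=
            Finset.sum_le_sum fun i _ => OrliczSpace.norm_absFun_le Φ μ _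
        _ ≤ ∑' n, ‖u n‖ := hu.sum_le_tsum _ fun _ _ => norm_nonneg _
        _ < a := by linarith
    refine le_of_eq_of_le (lintegral_congr_ae ?_) (OrliczSpace.modular_le_one hn)
    filter_upwards [OrliczSpace.coeFn_sum Φ μ (fun i => OrliczSpace.absFun (u i)) n,
      ae_all_iff.2 fun i => OrliczSpace.coeFn_absFun Φ μ (u i)] with x hx hx'
    simp only [hx, hx', hG]
  have h2 : ∫⁻ x, ⨆ n, Φ (G n x / a) ∂μ ≤ 1 := by
    rw [lintegral_iSup (f := fun n x => Φ (G n x / a))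
      (fun n => Φ.measurable.comp ((hGm n).div_const a)) (fun n m hnm x => Φ.mono (div_nonneg (hG0 n x) ha0.le)
        (div_le_div_of_nonneg_right (hGmono x hnm) ha0.le))]
    exact iSup_le h1
  have h3 : ∀ᵐ x ∂μ, ⨆ n, Φ (G n x / a) < ∞ :=
    ae_lt_top (Measurable.iSup fun n => Φ.measurable.comp ((hGm n).div_const a))
      (h2.trans_lt ENNReal.one_lt_top).ne
  filter_upwards [h3] with x hx
  obtain ⟨r, hr, hr0⟩ := ((Φ.tendsto_top.eventually (lt_mem_nhds hx)).and
    (eventually_ge_atTop 0)).exists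
  refine summable_of_sum_range_le (c := r * a) (fun _ => abs_nonneg _) fun n => ?_
  change G n x ≤ r * a
  rw [← div_le_iff₀ ha0]
  by_contra! hlt
  exact absurd (hr.trans_le (Φ.mono hr0 hlt.le)) (not_lt.2 (le_iSup (fun n => Φ (G n x / a)) n))

/-- Riesz–Fischer: an absolutely convergent series converges almost everywhere, and Fatou turns the
Cauchy property of its partial sums into convergence in norm. -/
theorem OrliczSpace.completeSpace (hΦ : ∀ x, Φ x ≠ ∞) : CompleteSpace (OrliczSpace Φ μ) := by
  refine NormedAddCommGroup.completeSpace_of_summable_imp_tendsto fun u hu => ?_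
  set s : ℕ → OrliczSpace Φ μ := fun n => ∑ i ∈ Finset.range n, u i with hs
  have hcauchy : CauchySeq s := cauchySeq_range_of_norm_bounded
    hu.hasSum.tendsto_sum_nat.cauchySeq fun i => le_rfl
  set g : X → ℝ := fun x => ∑' n, (u n : X →ₘ[μ] ℝ) x with hg
  have hlim : ∀ᵐ x ∂μ, Tendsto (fun n => (s n : X →ₘ[μ] ℝ) x) atTop (𝓝 (g x)) := by
    filter_upwards [OrliczSpace.ae_summable Φ μ u hu,
      ae_all_iff.2 fun n => OrliczSpace.coeFn_sum Φ μ u n] with x hx hx'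
    simp only [hs, hx']
    exact hx.of_abs.hasSum.tendsto_sum_nat
  have hgm : AEStronglyMeasurable g μ :=
    aestronglyMeasurable_of_tendsto_ae atTop (fun n => (s n : X →ₘ[μ] ℝ).aestronglyMeasurable) hlim
  have hlim' : ∀ᵐ x ∂μ,
      Tendsto (fun n => (s n : X →ₘ[μ] ℝ) x) atTop (𝓝 ((AEEqFun.mk g hgm : X →ₘ[μ] ℝ) x)) := by
    filter_upwards [hlim, AEEqFun.coeFn_mk g hgm] with x hx h'
    rwa [h']
  obtain ⟨R, hR⟩ : ∃ R, ∀ n, ‖s n‖ < R := by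
    obtain ⟨R, hR⟩ := hcauchy.isBounded_range.exists_norm_le
    exact ⟨R + 1, fun n => (hR _ ⟨n, rfl⟩).trans_lt (lt_add_one R)⟩
  have hR0 : 0 < R := (norm_nonneg _).trans_lt (hR 0)
  have hmem : (AEEqFun.mk g hgm : X →ₘ[μ] ℝ) ∈ OrliczSpace Φ μ := by
    refine ⟨R⁻¹, inv_pos.2 hR0, lt_of_le_of_lt ?_ ENNReal.one_lt_top⟩
    refine orliczModular_le_of_tendsto Φ μ hΦ (F := fun n x => R⁻¹ * (s n : X →ₘ[μ] ℝ) x)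
      (fun n => (s n : X →ₘ[μ] ℝ).aestronglyMeasurable.aemeasurable.const_mul _)
      (hlim'.mono fun x hx => hx.const_mul _) (Eventually.of_forall fun n => ?_)
    simpa only [div_eq_inv_mul] using OrliczSpace.modular_le_one (hR n)
  refine ⟨⟨_, hmem⟩, Metric.tendsto_atTop'.2 fun ε hε => ?_⟩
  obtain ⟨N, hN⟩ := Metric.cauchySeq_iff.1 hcauchy (ε / 2) (by positivity)
  refine ⟨N, fun n hn => ?_⟩
  rw [dist_eq_norm, norm_sub_rev]
  refine lt_of_le_of_lt (OrliczSpace.norm_le_of_modular (half_pos hε) ?_) (half_lt_self hε)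
  refine orliczModular_le_of_tendsto Φ μ hΦ
    (F := fun m x => ((s m - s n : OrliczSpace Φ μ) : X →ₘ[μ] ℝ) x / (ε / 2))
    (fun m => (AEEqFun.aestronglyMeasurable _).aemeasurable.div_const _) ?_ ?_
  · filter_upwards [hlim', ae_all_iff.2 fun m => OrliczSpace.coeFn_sub Φ μ (s m) (s n),
      OrliczSpace.coeFn_sub Φ μ ⟨_, hmem⟩ (s n)] with x hx h1 h2
    simp only [h1, h2]
    exact (hx.sub_const _).div_const _
  · filter_upwards [eventually_ge_atTop N] with m hm
    refine OrliczSpace.modular_le_one ?_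
    rw [← dist_eq_norm]
    exact hN m hm n hn.le

end Completeness

/-- Every partial sum is at most the sum of the first `n` terms plus half of itself. -/
lemma summable_of_add_le_half {a : ℕ → ℝ} (ha : ∀ k, 0 ≤ a k) {n : ℕ}
    (h : ∀ k, a (n + k) ≤ 1 / 2 * a k) : Summable a := by
  refine summable_of_sum_range_le (c := 2 * ∑ k ∈ Finset.range n, a k) ha fun m => ?_
  have h1 : ∑ k ∈ Finset.range m, a k ≤ ∑ k ∈ Finset.range (n + m), a k :=
    Finset.sum_le_sum_of_subset_of_nonneg (Finset.range_mono (by omega)) fun k _ _ => ha k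
  have h2 : ∑ k ∈ Finset.range m, a (n + k) ≤ 1 / 2 * ∑ k ∈ Finset.range m, a k := by
    rw [Finset.mul_sum]
    exact Finset.sum_le_sum fun k _ => h k
  rw [Finset.sum_range_add] at h1
  linarith

/-! ### Generalized hyperbolic operators -/

section GeneralizedHyperbolic

variable {E : Type*} [NormedAddCommGroup E] [NormedSpace ℝ E]

/-- The range of `P` is invariant under `U`, so the contraction applies again after any number of
steps. -/
lemma summable_norm_pow_mul {U P : E →L[ℝ] E} (hP : ∀ x, P (P x) = P x)
    (hU : ∀ x, P x = x → P (U x) = U x) {n : ℕ}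
    (hn : ∀ x, P x = x → ‖(U ^ n) x‖ ≤ 1 / 2 * ‖x‖) : Summable fun k : ℕ => ‖U ^ k * P‖ := by
  have hmem : ∀ (k : ℕ) x, P ((U ^ k) (P x)) = (U ^ k) (P x) := fun k x => by
    induction k with
    | zero => simpa using hP x
    | succ k ih =>
      rw [pow_succ']
      exact hU _ ih
  refine summable_of_add_le_half (fun _ => norm_nonneg _) (n := n) fun k => ?_
  refine ContinuousLinearMap.opNorm_le_bound _ (by positivity) fun x => ?_
  have e : (U ^ (n + k) * P) x = (U ^ n) ((U ^ k) (P x)) := by rw [pow_add]; rfl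
  rw [e, mul_assoc]
  refine (hn _ (hmem k x)).trans ?_
  gcongr
  exact (U ^ k * P).le_opNorm x

/-- Generalized hyperbolic operators are strongly structurally stable. -/
theorem isStronglyStructurallyStable_of_generalizedHyperbolic [CompleteSpace E]
    (T : E ≃L[ℝ] E) (P : E →L[ℝ] E) (hP : ∀ x, P (P x) = P x)
    (hM : ∀ x, P x = x → P (T x) = T x) (hN : ∀ x, P x = 0 → P (T.symm x) = 0)
    (hcM : ∃ n : ℕ, ∀ x, P x = x → ‖((T : E →L[ℝ] E) ^ n) x‖ ≤ 1 / 2 * ‖x‖)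
    (hcN : ∃ n : ℕ, ∀ x, P x = 0 → ‖((T.symm : E →L[ℝ] E) ^ n) x‖ ≤ 1 / 2 * ‖x‖) :
    IsStronglyStructurallyStable (T : E →L[ℝ] E) := by
  obtain ⟨n, hn⟩ := hcM
  obtain ⟨m, hm⟩ := hcN
  set U : E →L[ℝ] E := (T : E →L[ℝ] E) with hU
  set V : E →L[ℝ] E := (T.symm : E →L[ℝ] E) with hV
  set Q : E →L[ℝ] E := 1 - P with hQ
  have hQx : ∀ x, Q x = x - P x := fun x => rfl
  have hQ0 : ∀ x, Q x = x → P x = 0 := fun x h => by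
    rw [hQx] at h; simpa using h
  have hUV : U * V = 1 := ContinuousLinearMap.ext fun x => T.apply_symm_apply x
  have s1 : Summable fun k : ℕ => ‖U ^ k * P‖ := summable_norm_pow_mul hP hM hn
  have s2 : Summable fun k : ℕ => ‖V ^ k * Q‖ := by
    refine summable_norm_pow_mul (fun x => ?_) (fun x hx => ?_) (n := m)
      fun x hx => hm x (hQ0 x hx)
    · simp only [hQx, map_sub, hP]; abel
    · rw [hQx, show P (V x) = 0 from hN x (hQ0 x hx), sub_zero]
  -- The part `P` is propagated by `T` at negative indices, the part `Q` by its inverse at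
  -- nonnegative ones, with a minus sign. The differences telescope except at zero, where they give
  -- `P + Q = 1`.
  let A : ℤ → E →L[ℝ] E
    | Int.ofNat k => -(V ^ (k + 1) * Q)
    | Int.negSucc k => U ^ k * P
  refine isStronglyStructurallyStable_of_greenKernel T A ?_ ?_
  · refine Summable.of_nat_of_neg_add_one ?_ ?_
    · refine ((summable_nat_add_iff 1).2 s2).congr fun k => ?_
      exact (norm_neg _).symm
    · refine s1.congr fun k => ?_
      rw [← Int.negSucc_eq]
  · intro k
    change A (k - 1) - U * A k = _
    rcases k with (_ | k) | k
    · change U ^ 0 * P - U * -(V ^ (0 + 1) * Q) = _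
      simp only [pow_zero, one_mul, zero_add, pow_one, mul_neg, ← mul_assoc, hUV]
      simp [hQ]
    · rw [if_neg (by simp; omega)]
      have e : (Int.ofNat (k + 1) - 1 : ℤ) = Int.ofNat k := by simp
      rw [e]
      change -(V ^ (k + 1) * Q) - U * -(V ^ (k + 1 + 1) * Q) = 0
      rw [pow_succ' V (k + 1), mul_neg, ← mul_assoc U, ← mul_assoc U, hUV, one_mul]
      abel
    · rw [if_neg (by simp)]
      have e : (Int.negSucc k - 1 : ℤ) = Int.negSucc (k + 1) := by
        simp [Int.negSucc_eq]; ring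
      rw [e]
      change U ^ (k + 1) * P - U * (U ^ k * P) = 0
      rw [pow_succ', mul_assoc, sub_self]

end GeneralizedHyperbolic

/-! ### Restriction of functions to a measurable set -/

section Restriction

lemma abs_indicator_mul_le {Y : Type*} (S : Set Y) (f : Y → ℝ) (k : ℝ) (x : Y) :
    |k * S.indicator f x| ≤ |k * f x| := by
  by_cases hx : x ∈ S <;> simp [hx, mul_nonneg]

variable {X : Type*} [MeasurableSpace X] (Φ : YoungFunction) (μ : Measure X)

/-- The class of the indicator function of a measurable set. -/
noncomputable def aeIndicator (S : Set X) (hS : MeasurableSet S) : X →ₘ[μ] ℝ :=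
  AEEqFun.mk (S.indicator fun _ => (1 : ℝ)) (aestronglyMeasurable_const.indicator hS)

lemma aeIndicator_mul (S : Set X) (hS : MeasurableSet S) (f : X →ₘ[μ] ℝ) :
    (aeIndicator μ S hS * f : X →ₘ[μ] ℝ) =ᵐ[μ] S.indicator f := by
  filter_upwards [AEEqFun.coeFn_mul (aeIndicator μ S hS) f,
    AEEqFun.coeFn_mk (μ := μ) (S.indicator fun _ => (1 : ℝ))
      (aestronglyMeasurable_const.indicator hS)] with x h1 h2
  rw [h1, Pi.mul_apply, aeIndicator, h2]
  by_cases hx : x ∈ S <;> simp [hx]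

lemma aeIndicator_mul_add (S : Set X) (hS : MeasurableSet S) (f g : X →ₘ[μ] ℝ) :
    aeIndicator μ S hS * (f + g) = aeIndicator μ S hS * f + aeIndicator μ S hS * g := by
  refine AEEqFun.ext ?_
  filter_upwards [aeIndicator_mul μ S hS (f + g), aeIndicator_mul μ S hS f,
    aeIndicator_mul μ S hS g, AEEqFun.coeFn_add f g,
    AEEqFun.coeFn_add (aeIndicator μ S hS * f) (aeIndicator μ S hS * g)] with x h1 h2 h3 h4 h5
  rw [h1, h5, Pi.add_apply, h2, h3]
  by_cases hx : x ∈ S <;> simp [hx, h4]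

lemma aeIndicator_mul_smul (S : Set X) (hS : MeasurableSet S) (r : ℝ) (f : X →ₘ[μ] ℝ) :
    aeIndicator μ S hS * (r • f) = r • (aeIndicator μ S hS * f) := by
  refine AEEqFun.ext ?_
  filter_upwards [aeIndicator_mul μ S hS (r • f), aeIndicator_mul μ S hS f,
    AEEqFun.coeFn_smul r f, AEEqFun.coeFn_smul r (aeIndicator μ S hS * f)] with x h1 h2 h3 h4
  rw [h1, h4, Pi.smul_apply, h2]
  by_cases hx : x ∈ S <;> simp [hx, h3]

/-- Restriction of functions to a measurable set, as a projection of `L^Φ(μ)`. -/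
noncomputable def restrictTo (S : Set X) (hS : MeasurableSet S) :
    OrliczSpace Φ μ →L[ℝ] OrliczSpace Φ μ :=
  LinearMap.mkContinuous
    { toFun := fun f => ⟨aeIndicator μ S hS * (f : X →ₘ[μ] ℝ), by
        obtain ⟨k, hk, hf⟩ := f.2
        refine ⟨k, hk, lt_of_le_of_lt ?_ hf⟩
        rw [orliczModular_congr Φ μ (g := fun x => k * S.indicator (f : X →ₘ[μ] ℝ) x)
          ((aeIndicator_mul μ S hS f).mono fun x hx => by simp only [hx])]
        exact orliczModular_mono Φ μ fun x => abs_indicator_mul_le S _ k x⟩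
      map_add' := fun f g => Subtype.ext (aeIndicator_mul_add μ S hS f g)
      map_smul' := fun r f => Subtype.ext (aeIndicator_mul_smul μ S hS r f) } 1 fun f =>
    OrliczSpace.norm_le_mul_of_modular one_pos fun a _ h => by
      refine le_trans ?_ h
      rw [one_mul, orliczModular_congr Φ μ
        (g := fun x => a⁻¹ * S.indicator (f : X →ₘ[μ] ℝ) x)
        ((aeIndicator_mul μ S hS f).mono fun x hx => ?_)]
      · refine orliczModular_mono Φ μ fun x => ?_
        rw [div_eq_inv_mul]
        exact abs_indicator_mul_le S _ _ x
      · rw [div_eq_inv_mul]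
        exact congrArg (a⁻¹ * ·) hx

lemma restrictTo_ae (S : Set X) (hS : MeasurableSet S) (f : OrliczSpace Φ μ) :
    (restrictTo Φ μ S hS f : X →ₘ[μ] ℝ) =ᵐ[μ] S.indicator (f : X →ₘ[μ] ℝ) :=
  aeIndicator_mul μ S hS f

lemma OrliczSpace.ext_ae {f g : OrliczSpace Φ μ}
    (h : (f : X →ₘ[μ] ℝ) =ᵐ[μ] (g : X →ₘ[μ] ℝ)) : f = g :=
  Subtype.ext (AEEqFun.ext h)

lemma restrictTo_eq_self_iff (S : Set X) (hS : MeasurableSet S) (f : OrliczSpace Φ μ) :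
    restrictTo Φ μ S hS f = f ↔ ∀ᵐ x ∂μ, x ∉ S → (f : X →ₘ[μ] ℝ) x = 0 := by
  constructor
  · intro h
    filter_upwards [restrictTo_ae Φ μ S hS f] with x hx hxS
    rw [h] at hx
    rw [hx, Set.indicator_of_notMem hxS]
  · intro h
    refine OrliczSpace.ext_ae Φ μ ?_
    filter_upwards [restrictTo_ae Φ μ S hS f, h] with x hx h'
    rw [hx]
    by_cases hxS : x ∈ S <;> simp [hxS, h']

lemma restrictTo_eq_zero_iff (S : Set X) (hS : MeasurableSet S) (f : OrliczSpace Φ μ) :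
    restrictTo Φ μ S hS f = 0 ↔ ∀ᵐ x ∂μ, x ∈ S → (f : X →ₘ[μ] ℝ) x = 0 := by
  constructor
  · intro h
    filter_upwards [restrictTo_ae Φ μ S hS f, OrliczSpace.coeFn_zero Φ μ] with x hx h0 hxS
    rw [h, h0, Set.indicator_of_mem hxS] at hx
    exact hx.symm
  · intro h
    refine OrliczSpace.ext_ae Φ μ ?_
    filter_upwards [restrictTo_ae Φ μ S hS f, OrliczSpace.coeFn_zero Φ μ, h] with x hx h0 h'
    rw [hx, h0]
    by_cases hxS : x ∈ S <;> simp [hxS, h']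

lemma restrictTo_idem (S : Set X) (hS : MeasurableSet S) (f : OrliczSpace Φ μ) :
    restrictTo Φ μ S hS (restrictTo Φ μ S hS f) = restrictTo Φ μ S hS f := by
  rw [restrictTo_eq_self_iff]
  filter_upwards [restrictTo_ae Φ μ S hS f] with x hx hxS
  rw [hx, Set.indicator_of_notMem hxS]

end Restriction

/-! ### Composition operators of invertible systems -/

namespace IsCompositionSystem

variable {X : Type*} [MeasurableSpace X] {μ : Measure X} {φ : Equiv.Perm X}

lemma inverse (h : IsCompositionSystem μ φ)
    (hinv : ∃ c : ℝ≥0, 0 < c ∧ ∀ A : Set X, MeasurableSet A → μ (φ '' A) ≤ c * μ A) :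
    IsCompositionSystem μ φ⁻¹ where
  measurable := h.measurable_symm
  measurable_symm := h.measurable
  bound := by
    obtain ⟨c, hc, hA⟩ := hinv
    refine ⟨c, hc, fun A hA' => ?_⟩
    rw [Equiv.Perm.inv_def, ← Equiv.image_eq_preimage_symm]
    exact hA A hA'

lemma quasi_pow (h : IsCompositionSystem μ φ) (n : ℕ) :
    Measure.QuasiMeasurePreserving (φ ^ n : Equiv.Perm X) μ μ := by
  rw [Equiv.Perm.coe_pow]
  exact h.quasi.iterate n

lemma compositionOperator_pow_ae (h : IsCompositionSystem μ φ) (Φ : YoungFunction) (n : ℕ)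
    (f : OrliczSpace Φ μ) :
    (((h.compositionOperator Φ ^ n) f : OrliczSpace Φ μ) : X →ₘ[μ] ℝ) =ᵐ[μ]
      (f : X →ₘ[μ] ℝ) ∘ (φ ^ n : Equiv.Perm X) := by
  induction n with
  | zero => exact ae_eq_refl _
  | succ n ih =>
    rw [pow_succ', pow_succ, Equiv.Perm.coe_mul, ← Function.comp_assoc]
    exact (h.compositionOperator_ae Φ _).trans (h.quasi.ae_eq_comp ih)

/-- The composition operator of an invertible system, as a linear homeomorphism. -/
noncomputable def compositionEquiv (h : IsCompositionSystem μ φ) (h' : IsCompositionSystem μ φ⁻¹)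
    (Φ : YoungFunction) : OrliczSpace Φ μ ≃L[ℝ] OrliczSpace Φ μ :=
  ContinuousLinearEquiv.equivOfInverse (h.compositionOperator Φ) (h'.compositionOperator Φ)
    (fun f => OrliczSpace.ext_ae Φ μ <| by
      filter_upwards [h'.compositionOperator_ae Φ (h.compositionOperator Φ f),
        h'.quasi.ae_eq_comp (h.compositionOperator_ae Φ f)] with x h1 h2
      rw [h1, h2]
      simp)
    (fun f => OrliczSpace.ext_ae Φ μ <| by
      filter_upwards [h.compositionOperator_ae Φ (h'.compositionOperator Φ f),
        h.quasi.ae_eq_comp (h'.compositionOperator_ae Φ f)] with x h1 h2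
      rw [h1, h2]
      simp)

/-- If `C_φ` contracts the functions supported in a set `S` with `φ⁻¹(S) ⊆ S`, and `C_φ⁻¹` those
supported in its complement, then `C_φ` is strongly structurally stable. -/
theorem isStronglyStructurallyStable_of_set (h : IsCompositionSystem μ φ)
    (h' : IsCompositionSystem μ φ⁻¹) (Φ : YoungFunction) [CompleteSpace (OrliczSpace Φ μ)]
    {S : Set X} (hS : MeasurableSet S) (hφS : ∀ x, φ x ∈ S → x ∈ S)
    (hc : ∃ n : ℕ, ∀ f : OrliczSpace Φ μ, (∀ᵐ x ∂μ, x ∉ S → (f : X →ₘ[μ] ℝ) x = 0) →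
      ‖(h.compositionOperator Φ ^ n) f‖ ≤ 1 / 2 * ‖f‖)
    (hc' : ∃ n : ℕ, ∀ f : OrliczSpace Φ μ, (∀ᵐ x ∂μ, x ∉ Sᶜ → (f : X →ₘ[μ] ℝ) x = 0) →
      ‖(h'.compositionOperator Φ ^ n) f‖ ≤ 1 / 2 * ‖f‖) :
    IsStronglyStructurallyStable (h.compositionOperator Φ) := by
  -- The projection is restriction to `S`. The one inclusion `φ⁻¹(S) ⊆ S` gives both invariances: of
  -- its range under `C_φ` and of its kernel under the inverse.
  refine isStronglyStructurallyStable_of_generalizedHyperbolic (h.compositionEquiv h' Φ)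
    (restrictTo Φ μ S hS) (restrictTo_idem Φ μ S hS) (fun f hf => ?_) (fun f hf => ?_)
    (hc.imp fun n hn f hf => hn f ((restrictTo_eq_self_iff Φ μ S hS f).1 hf))
    (hc'.imp fun n hn f hf => hn f ?_)
  · rw [restrictTo_eq_self_iff] at hf ⊢
    filter_upwards [h.compositionOperator_ae Φ f, h.quasi.ae hf] with x h1 h2 hx
    exact h1.trans (h2 fun hx' => hx (hφS x hx'))
  · rw [restrictTo_eq_zero_iff] at hf ⊢
    filter_upwards [h'.compositionOperator_ae Φ f, h'.quasi.ae hf] with x h1 h2 hx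
    exact h1.trans (h2 (hφS _ (by simpa using hx)))
  · simpa using (restrictTo_eq_zero_iff Φ μ S hS f).1 hf

end IsCompositionSystem

/-! ### Gauge norms of indicator functions -/

section IndicatorGauge

variable {X : Type*} [MeasurableSpace X] (Φ : YoungFunction) (μ : Measure X)

/-- The gauge norm of the indicator function of a set. -/
noncomputable def indicatorGauge (A : Set X) : ℝ :=
  gaugeNorm Φ μ (A.indicator fun _ => (1 : ℝ))

variable {Φ μ} {A A' : Set X}

lemma orliczModular_indicator_mul (hA : MeasurableSet A) (k : ℝ) :
    orliczModular Φ μ (fun x => k * A.indicator (fun _ => (1 : ℝ)) x) = Φ k * μ A := by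
  rw [← lintegral_indicator_const hA]
  refine lintegral_congr fun x => ?_
  by_cases hx : x ∈ A <;> simp [hx, Φ.map_zero]

lemma orliczModular_indicator_div (hA : MeasurableSet A) (k : ℝ) :
    orliczModular Φ μ (fun x => A.indicator (fun _ => (1 : ℝ)) x / k) = Φ k⁻¹ * μ A := by
  simpa only [div_eq_inv_mul] using orliczModular_indicator_mul hA k⁻¹

lemma one_lt_of_lt_indicatorGauge (hA : MeasurableSet A) {k : ℝ} (hk : 0 < k)
    (h : k < indicatorGauge Φ μ A) : 1 < Φ k⁻¹ * μ A := by
  by_contra! hle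
  rw [← orliczModular_indicator_div hA] at hle
  exact absurd h (not_lt.2 (gaugeNorm_le Φ μ hk hle))

lemma le_one_of_indicatorGauge_lt (hΦ : ∃ x, 0 < x ∧ Φ x ≠ ∞) (hA : MeasurableSet A)
    (hfin : μ A ≠ ∞) {k : ℝ} (h : indicatorGauge Φ μ A < k) : Φ k⁻¹ * μ A ≤ 1 := by
  rw [← orliczModular_indicator_div hA]
  obtain ⟨x, hx, hΦx⟩ := hΦ
  refine modular_le_one_of_gaugeNorm_lt Φ μ ⟨x, hx, ?_⟩ h
  rw [orliczModular_indicator_mul hA]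
  exact ENNReal.mul_lt_top hΦx.lt_top hfin.lt_top

lemma indicatorGauge_pos (hΦ : ∃ x, 0 < x ∧ Φ x ≠ ∞) (hA : MeasurableSet A)
    (hfin : μ A ≠ ∞) (hpos : μ A ≠ 0) : 0 < indicatorGauge Φ μ A := by
  by_contra! hle
  obtain ⟨r, hr, hr0⟩ := ((Φ.tendsto_top.eventually
    (lt_mem_nhds (ENNReal.inv_lt_top.2 (pos_iff_ne_zero.2 hpos)))).and
      (eventually_gt_atTop 0)).exists
  have h1 := le_one_of_indicatorGauge_lt hΦ hA hfin (hle.trans_lt (inv_pos.2 hr0))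
  rw [inv_inv] at h1
  refine absurd h1 (not_le.2 ?_)
  calc (1 : ℝ≥0∞) = (μ A)⁻¹ * μ A := (ENNReal.inv_mul_cancel hpos hfin).symm
    _ < Φ r * μ A := ENNReal.mul_lt_mul_left hpos hfin hr

/-- A strong comparison of the gauges of two sets passes to their measures. -/
lemma measure_le_of_indicatorGauge_le (hΦ : ∃ x, 0 < x ∧ Φ x ≠ ∞) (hA : MeasurableSet A)
    (hA' : MeasurableSet A') (hfin' : μ A' ≠ ∞) (hN : 0 < indicatorGauge Φ μ A)
    {t : ℝ≥0} (ht : 0 < t) (ht1 : t ≤ 1)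
    (h : indicatorGauge Φ μ A' ≤ t / 2 * indicatorGauge Φ μ A) : μ A' ≤ t * μ A := by
  -- Any factor strictly between `1 / 2` and `1` would do: `k` lies below the gauge of `A` while `t
  -- * k` lies above that of `A'`. Convexity then trades the factor `t` in the argument of `Φ` for a
  -- factor `t` in its value.
  set k : ℝ := 3 / 4 * indicatorGauge Φ μ A with hk
  have hk0 : 0 < k := by positivity
  have ht' : (0 : ℝ) < t := ht
  have h1 := one_lt_of_lt_indicatorGauge hA hk0 (by linarith)
  have h2 : Φ (t * k)⁻¹ * μ A' ≤ 1 := by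
    refine le_one_of_indicatorGauge_lt hΦ hA' hfin' (h.trans_lt ?_)
    nlinarith [mul_pos ht' hN]
  have h3 : Φ k⁻¹ ≤ t * Φ (t * k)⁻¹ := by
    have := Φ.smul_le t ht1 (t * k)⁻¹
    rwa [mul_inv, mul_inv_cancel_left₀ ht'.ne', ← mul_inv] at this
  calc μ A' ≤ μ A' * (Φ k⁻¹ * μ A) := le_mul_of_one_le_right' h1.le
    _ ≤ μ A' * (t * Φ (t * k)⁻¹ * μ A) := by gcongr
    _ = t * μ A * (Φ (t * k)⁻¹ * μ A') := by ring
    _ ≤ t * μ A * 1 := by gcongr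
    _ = t * μ A := mul_one _

/-- The condition `Φ x > 1 / μ A` says that `x` times the indicator has modular above one, so up to
endpoints that `1 / x` is below the gauge. -/
lemma inverse_eq_indicatorGauge (hΦ : ∃ x, 0 < x ∧ Φ x ≠ ∞) (hA : MeasurableSet A)
    (hfin : μ A ≠ ∞) (hpos : μ A ≠ 0) :
    Φ.inverse (1 / μ A) = ENNReal.ofReal (indicatorGauge Φ μ A)⁻¹ := by
  have hN := indicatorGauge_pos hΦ hA hfin hpos
  refine le_antisymm ?_ (le_iInf₂ fun x hx => ?_)
  · by_contra! hlt
    obtain ⟨q, hq, hq'⟩ := ENNReal.lt_iff_exists_nnreal_btwn.1 hlt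
    have hq1 : (indicatorGauge Φ μ A)⁻¹ < q := by
      rwa [ENNReal.ofReal_lt_coe_iff (by positivity)] at hq
    have hq0 : (0 : ℝ) < q := (inv_pos.2 hN).trans hq1
    have := one_lt_of_lt_indicatorGauge hA (inv_pos.2 hq0) (inv_lt_of_inv_lt₀ hN hq1)
    rw [inv_inv] at this
    refine absurd hq' (not_lt.2 (iInf₂_le q ?_))
    exact (ENNReal.div_lt_iff (Or.inl hpos) (Or.inl hfin)).2 this
  · by_contra! hlt
    have hx1 : (x : ℝ) < (indicatorGauge Φ μ A)⁻¹ := by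
      rwa [← ENNReal.ofReal_coe_nnreal, ENNReal.ofReal_lt_ofReal_iff (by positivity)] at hlt
    have hx0 : (0 : ℝ) < x := by
      refine lt_of_le_of_ne x.2 fun h0 => ?_
      rw [← h0, Φ.map_zero] at hx
      exact absurd hx (by simp)
    have := le_one_of_indicatorGauge_lt hΦ hA hfin (lt_inv_of_lt_inv₀ hx0 hx1)
    rw [inv_inv] at this
    exact absurd ((ENNReal.div_lt_iff (Or.inl hpos) (Or.inl hfin)).1 hx) (not_lt.2 this)

end IndicatorGauge

/-! ### Exponential rates and uniform decay -/

section Rates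

/-- Roots below some `r < 1` bound the terms by `r ^ n`, uniformly in the index. Only this decay is
used later. -/
lemma eventually_le_of_limsup_rpow_lt_one {ι : Type*} {a : ℕ → ι → ℝ≥0∞}
    (h : limsup (fun n : ℕ => ⨆ i, a n i ^ (1 / (n : ℝ))) atTop < 1) {t : ℝ≥0∞} (ht : 0 < t) :
    ∀ᶠ n in atTop, ∀ i, a n i ≤ t := by
  obtain ⟨r, hr, hr1⟩ := exists_between h
  filter_upwards [eventually_lt_of_limsup_lt hr, eventually_gt_atTop 0,
    (ENNReal.tendsto_pow_atTop_nhds_zero_of_lt_one hr1).eventually (gt_mem_nhds ht)]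
    with n h1 h2 h3 i
  have hn : (0 : ℝ) < n := by exact_mod_cast h2
  have h4 : a n i ^ (1 / (n : ℝ)) ≤ r := (le_iSup (fun i => a n i ^ (1 / (n : ℝ))) i).trans h1.le
  calc a n i = (a n i ^ (1 / (n : ℝ))) ^ (n : ℝ) := by
        rw [← ENNReal.rpow_mul, one_div_mul_cancel hn.ne', ENNReal.rpow_one]
    _ ≤ r ^ (n : ℝ) := by gcongr
    _ = r ^ n := ENNReal.rpow_natCast _ _
    _ ≤ t := h3.le

lemma eventually_le_of_one_lt_liminf_rpow {ι : Type*} {a : ℕ → ι → ℝ≥0∞}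
    (h : 1 < liminf (fun n : ℕ => ⨅ i, a n i ^ (1 / (n : ℝ))) atTop) {t : ℝ≥0∞} (ht : t < ∞) :
    ∀ᶠ n in atTop, ∀ i, t ≤ a n i := by
  obtain ⟨r, hr1, hr⟩ := exists_between h
  filter_upwards [eventually_lt_of_lt_liminf hr, eventually_gt_atTop 0,
    (ENNReal.tendsto_pow_atTop_nhds_zero_of_lt_one (ENNReal.inv_lt_one.2 hr1)).eventually
      (gt_mem_nhds (ENNReal.inv_pos.2 ht.ne))]
    with n h1 h2 h3 i
  have hn : (0 : ℝ) < n := by exact_mod_cast h2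
  have h4 : r ≤ a n i ^ (1 / (n : ℝ)) := h1.le.trans (iInf_le (fun i => a n i ^ (1 / (n : ℝ))) i)
  rw [← ENNReal.inv_pow, ENNReal.inv_lt_inv] at h3
  calc t ≤ r ^ n := h3.le
    _ = r ^ (n : ℝ) := (ENNReal.rpow_natCast _ _).symm
    _ ≤ (a n i ^ (1 / (n : ℝ))) ^ (n : ℝ) := by gcongr
    _ = a n i := by rw [← ENNReal.rpow_mul, one_div_mul_cancel hn.ne', ENNReal.rpow_one]

variable {w : ℤ → ℝ} {u : ℤ → ℝ≥0∞}

/-- Passing to reciprocals inverts the ratio. The index maps `i` and `j` let one statement serve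
both full and half lines. -/
lemma eventually_le_mul_of_limsup (hw : ∀ k, 0 < w k) (hu : ∀ k, u k = ENNReal.ofReal (w k)⁻¹)
    {ι : Type*} {i j : ℕ → ι → ℤ}
    (h : limsup (fun n : ℕ => ⨆ k, (u (i n k) / u (j n k)) ^ (1 / (n : ℝ))) atTop < 1) {t : ℝ}
    (ht : 0 < t) : ∀ᶠ n in atTop, ∀ k, w (j n k) ≤ t * w (i n k) := by
  filter_upwards [eventually_le_of_limsup_rpow_lt_one h (ENNReal.ofReal_pos.2 ht)] with n hn k
  have h1 := hn k
  rw [hu, hu, ← ENNReal.ofReal_div_of_pos (inv_pos.2 (hw _)),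
    ENNReal.ofReal_le_ofReal_iff ht.le, div_inv_eq_mul, inv_mul_le_iff₀ (hw _)] at h1
  linarith

lemma eventually_le_mul_of_liminf (hw : ∀ k, 0 < w k) (hu : ∀ k, u k = ENNReal.ofReal (w k)⁻¹)
    {ι : Type*} {i j : ℕ → ι → ℤ}
    (h : 1 < liminf (fun n : ℕ => ⨅ k, (u (i n k) / u (j n k)) ^ (1 / (n : ℝ))) atTop) {t : ℝ}
    (ht : 0 < t) : ∀ᶠ n in atTop, ∀ k, w (i n k) ≤ t * w (j n k) := by
  filter_upwards [eventually_le_of_one_lt_liminf_rpow h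
    (ENNReal.ofReal_lt_top (r := t⁻¹))] with n hn k
  have h1 := hn k
  rw [hu, hu, ← ENNReal.ofReal_div_of_pos (inv_pos.2 (hw _)),
    ENNReal.ofReal_le_ofReal_iff (by have := hw (i n k); have := hw (j n k); positivity),
    div_inv_eq_mul, inv_mul_eq_div, le_div_iff₀ (hw _), inv_mul_le_iff₀ ht] at h1
  exact h1

/-- Only windows across `0` need an argument. If the window is long, one of its two pieces is long
and gains the factor `t / B`, while the other, however short, loses at most `B`. -/
lemma eventually_le_mul_of_half_lines (hw : ∀ k, 0 < w k)
    (h₁ : ∀ t : ℝ, 0 < t → ∀ᶠ n : ℕ in atTop, ∀ k : ℤ, k ≤ 0 → w (k - n) ≤ t * w k)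
    (h₂ : ∀ t : ℝ, 0 < t → ∀ᶠ n : ℕ in atTop, ∀ k : ℤ, 0 ≤ k → w k ≤ t * w (k + n))
    {t : ℝ} (ht : 0 < t) : ∀ᶠ n : ℕ in atTop, ∀ k : ℤ, w k ≤ t * w (k + n) := by
  obtain ⟨B, hB0, hB1, hB2⟩ : ∃ B : ℝ, 0 < B ∧ (∀ m : ℕ, w (-m) ≤ B * w 0) ∧
      ∀ m : ℕ, w 0 ≤ B * w m := by
    obtain ⟨n₁, hn₁⟩ := eventually_atTop.1 (h₁ 1 one_pos)
    obtain ⟨n₂, hn₂⟩ := eventually_atTop.1 (h₂ 1 one_pos)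
    -- The sums absorb the finitely many short distances; beyond the thresholds `n₁` and `n₂` the
    -- ratios are at most one.
    set B := 1 + ∑ m ∈ Finset.range n₁, w (-m) / w 0 + ∑ m ∈ Finset.range n₂, w 0 / w m
    have s1 : 0 ≤ ∑ m ∈ Finset.range n₁, w (-m) / w 0 :=
      Finset.sum_nonneg fun m _ => (div_pos (hw _) (hw _)).le
    have s2 : 0 ≤ ∑ m ∈ Finset.range n₂, w 0 / w m :=
      Finset.sum_nonneg fun m _ => (div_pos (hw _) (hw _)).le
    refine ⟨B, by positivity, fun m => ?_, fun m => ?_⟩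
    · rw [← div_le_iff₀ (hw 0)]
      rcases lt_or_ge m n₁ with hm | hm
      · have := Finset.single_le_sum (f := fun m : ℕ => w (-m) / w 0)
          (fun m _ => (div_pos (hw _) (hw _)).le) (Finset.mem_range.2 hm)
        linarith
      · have := hn₁ m hm 0 le_rfl
        rw [one_mul, zero_sub, ← div_le_one (hw 0)] at this
        linarith
    · rw [← div_le_iff₀ (hw m)]
      rcases lt_or_ge m n₂ with hm | hm
      · have := Finset.single_le_sum (f := fun m : ℕ => w 0 / w m)
          (fun m _ => (div_pos (hw _) (hw _)).le) (Finset.mem_range.2 hm)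
        linarith
      · have := hn₂ m hm 0 le_rfl
        rw [one_mul, zero_add, ← div_le_one (hw m)] at this
        linarith
  obtain ⟨n₁, hn₁⟩ := eventually_atTop.1 ((h₁ (t / B) (by positivity)).and (h₁ t ht))
  obtain ⟨n₂, hn₂⟩ := eventually_atTop.1 ((h₂ (t / B) (by positivity)).and (h₂ t ht))
  filter_upwards [eventually_ge_atTop (n₁ + n₂)] with n hn k
  rcases le_total 0 k with hk | hk
  · exact (hn₂ n (by omega)).2 k hk
  rcases le_total (k + n) 0 with hkn | hkn
  · simpa using (hn₁ n (by omega)).2 (k + n) hkn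
  obtain ⟨p, rfl⟩ : ∃ p : ℕ, k = -p := ⟨k.natAbs, by omega⟩
  obtain ⟨q, hq⟩ : ∃ q : ℕ, -(p : ℤ) + n = q := ⟨(-(p : ℤ) + n).natAbs, by omega⟩
  rw [hq]
  have hcase : n₁ ≤ p ∨ n₂ ≤ q := by omega
  rcases hcase with hp | hp
  · have h3 := (hn₁ p hp).1 0 le_rfl
    rw [zero_sub] at h3
    calc w (-p) ≤ t / B * w 0 := h3
      _ ≤ t / B * (B * w q) := by gcongr; exact hB2 q
      _ = t * w q := by field_simp
  · have h3 := (hn₂ q hp).1 0 le_rfl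
    rw [zero_add] at h3
    calc w (-p) ≤ B * w 0 := hB1 p
      _ ≤ B * (t / B * w q) := by gcongr
      _ = t * w q := by field_simp

lemma le_pow_mul_of_step {w : ℤ → ℝ} {t : ℝ} (ht : 0 ≤ t) {n : ℕ} {i : ℤ}
    (h : ∀ k ≤ i, w (k - n) ≤ t * w k) (m : ℕ) : w (i - m * n) ≤ t ^ m * w i := by
  induction m with
  | zero => simp
  | succ m ih =>
    have h1 := h (i - m * n) (by have : (0 : ℤ) ≤ m * n := by positivity
                                 omega)
    calc w (i - (m + 1 : ℕ) * n) = w (i - m * n - n) := by congr 1; push_cast; ring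
      _ ≤ t * w (i - m * n) := h1
      _ ≤ t * (t ^ m * w i) := by gcongr
      _ = t ^ (m + 1) * w i := by ring

lemma exists_lt_of_step {w : ℤ → ℝ} {n : ℕ} {i : ℤ}
    (h : ∀ k ≤ i, w (k - n) ≤ 1 / 4 * w k) {s : ℝ} (hs : 0 < s) :
    ∃ m : ℕ, w (i - m * n) < s := by
  have hlim : Tendsto (fun m : ℕ => (1 / 4 : ℝ) ^ m * w i) atTop (𝓝 0) := by
    simpa using (tendsto_pow_atTop_nhds_zero_of_lt_one (by norm_num : (0 : ℝ) ≤ 1 / 4)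
      (by norm_num)).mul_const (w i)
  obtain ⟨m, hm⟩ := (hlim.eventually (gt_mem_nhds hs)).exists
  exact ⟨m, (le_pow_mul_of_step (by norm_num) h m).trans_lt hm⟩

end Rates

lemma Equiv.Perm.zpow_image_zpow_image {X : Type*} (φ : Equiv.Perm X) (j k : ℤ) (A : Set X) :
    (φ ^ j : Equiv.Perm X) '' ((φ ^ k : Equiv.Perm X) '' A) =
      (φ ^ (j + k) : Equiv.Perm X) '' A := by
  rw [← Set.image_comp, zpow_add, Equiv.Perm.coe_mul]

lemma Equiv.Perm.zpow_preimage {X : Type*} (φ : Equiv.Perm X) (k : ℤ) (A : Set X) :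
    (φ ^ k : Equiv.Perm X) ⁻¹' A = (φ ^ (-k) : Equiv.Perm X) '' A := by
  rw [zpow_neg, Equiv.Perm.inv_def, Equiv.image_symm_eq_preimage]

lemma Equiv.Perm.inv_zpow_image {X : Type*} (φ : Equiv.Perm X) (k : ℤ) (A : Set X) :
    (φ⁻¹ ^ k : Equiv.Perm X) '' A = (φ ^ (-k) : Equiv.Perm X) '' A := by
  rw [inv_zpow']

/-! ### Levels of a dissipative system -/

section DissipativeSystems

variable {X : Type*} [MeasurableSpace X]

/-- The gauge norm of the indicator function of the level `φᵏ(W)`. -/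
noncomputable def levelGauge (Φ : YoungFunction) (μ : Measure X) (φ : Equiv.Perm X) (W : Set X)
    (k : ℤ) : ℝ :=
  indicatorGauge Φ μ ((φ ^ k : Equiv.Perm X) '' W)

lemma levelGauge_inv (Φ : YoungFunction) (μ : Measure X) (φ : Equiv.Perm X) (W : Set X) (k : ℤ) :
    levelGauge Φ μ φ⁻¹ W k = levelGauge Φ μ φ W (-k) := by
  rw [levelGauge, levelGauge, Equiv.Perm.inv_zpow_image]

/-- The sign changes because composition takes preimages; the distortion hypothesis at `k` thus
concerns the level `-k`. -/
lemma indicatorNorm_eq (Φ : YoungFunction) (μ : Measure X) (φ : Equiv.Perm X) (k : ℤ) (F : Set X) :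
    indicatorNorm Φ μ φ k F = indicatorGauge Φ μ ((φ ^ (-k) : Equiv.Perm X) '' F) := by
  rw [← Equiv.Perm.zpow_preimage]
  rfl

section Levels

variable {μ : Measure X} {φ : Equiv.Perm X} {Φ : YoungFunction} {W : Set X}

lemma IsDissipative.inv (hW : IsDissipative μ φ W) : IsDissipative μ φ⁻¹ W where
  measurableSet := hW.measurableSet
  pos := hW.pos
  lt_top := hW.lt_top
  iUnion_eq := by
    simp only [Equiv.Perm.inv_zpow_image]
    rw [← hW.iUnion_eq]
    exact (Equiv.neg ℤ).iSup_comp (g := fun k : ℤ => (φ ^ k : Equiv.Perm X) '' W)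
  disjoint := fun j k hjk => by
    simp only [Equiv.Perm.inv_zpow_image]
    exact hW.disjoint (by simpa using hjk)

lemma HasBoundedDistortion.inv (h : HasBoundedDistortion Φ μ φ W) :
    HasBoundedDistortion Φ μ φ⁻¹ W := by
  obtain ⟨K, hK, h⟩ := h
  refine ⟨K, hK, fun k F hF hFW hpos => ?_⟩
  have e : ∀ (k : ℤ) (F : Set X), indicatorNorm Φ μ φ⁻¹ k F = indicatorNorm Φ μ φ (-k) F :=
    fun k F => by rw [indicatorNorm_eq, indicatorNorm_eq, Equiv.Perm.inv_zpow_image]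
  simpa only [e, neg_zero] using h (-k) F hF hFW hpos

namespace IsCompositionSystem

lemma measurable_zpow (h : IsCompositionSystem μ φ) (k : ℤ) :
    Measurable (φ ^ k : Equiv.Perm X) := by
  obtain ⟨n, rfl | rfl⟩ := k.eq_nat_or_neg
  · rw [zpow_natCast, Equiv.Perm.coe_pow]
    exact h.measurable.iterate n
  · rw [zpow_neg, zpow_natCast, ← inv_pow, Equiv.Perm.coe_pow]
    exact h.measurable_symm.iterate n

lemma measurableSet_zpow_image (h : IsCompositionSystem μ φ) (k : ℤ) {A : Set X}
    (hA : MeasurableSet A) : MeasurableSet ((φ ^ k : Equiv.Perm X) '' A) := by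
  have := h.measurable_zpow (-k) hA
  rwa [Equiv.Perm.zpow_preimage, neg_neg] at this

lemma measure_pow_preimage_le (h : IsCompositionSystem μ φ) (n : ℕ) :
    ∃ c : ℝ≥0, ∀ A : Set X, MeasurableSet A → μ ((φ ^ n : Equiv.Perm X) ⁻¹' A) ≤ c * μ A := by
  obtain ⟨c, -, hc⟩ := h.bound
  refine ⟨c ^ n, fun A hA => ?_⟩
  induction n generalizing A with
  | zero => simp
  | succ n ih =>
    rw [pow_succ', Equiv.Perm.coe_mul, Set.preimage_comp]
    calc _ ≤ ((c ^ n : ℝ≥0) : ℝ≥0∞) * μ (φ ⁻¹' A) := ih _ (h.measurable hA)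
      _ ≤ ((c ^ n : ℝ≥0) : ℝ≥0∞) * (c * μ A) := by gcongr; exact hc A hA
      _ = _ := by rw [pow_succ]; push_cast; ring

lemma measure_zpow_image_le (h : IsCompositionSystem μ φ) (h' : IsCompositionSystem μ φ⁻¹)
    (k : ℤ) :
    ∃ c : ℝ≥0, ∀ A : Set X, MeasurableSet A → μ ((φ ^ k : Equiv.Perm X) '' A) ≤ c * μ A := by
  obtain ⟨n, rfl | rfl⟩ := k.eq_nat_or_neg
  · obtain ⟨c, hc⟩ := h'.measure_pow_preimage_le n
    refine ⟨c, fun A hA => ?_⟩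
    have e : (φ ^ (n : ℤ) : Equiv.Perm X) '' A = (φ⁻¹ ^ n : Equiv.Perm X) ⁻¹' A := by
      rw [← zpow_natCast, Equiv.Perm.zpow_preimage, Equiv.Perm.inv_zpow_image, neg_neg]
    rw [e]
    exact hc A hA
  · obtain ⟨c, hc⟩ := h.measure_pow_preimage_le n
    refine ⟨c, fun A hA => ?_⟩
    rw [← Equiv.Perm.zpow_preimage, zpow_natCast]
    exact hc A hA

lemma measure_zpow_image_ne_top (h : IsCompositionSystem μ φ) (h' : IsCompositionSystem μ φ⁻¹)
    (k : ℤ) {A : Set X} (hA : MeasurableSet A) (hfin : μ A ≠ ∞) :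
    μ ((φ ^ k : Equiv.Perm X) '' A) ≠ ∞ := by
  obtain ⟨c, hc⟩ := h.measure_zpow_image_le h' k
  exact ((hc A hA).trans_lt (ENNReal.mul_lt_top ENNReal.coe_lt_top hfin.lt_top)).ne

lemma measure_zpow_image_eq_zero (h : IsCompositionSystem μ φ) (h' : IsCompositionSystem μ φ⁻¹)
    (k : ℤ) {A : Set X} (hA : MeasurableSet A) (h0 : μ A = 0) :
    μ ((φ ^ k : Equiv.Perm X) '' A) = 0 := by
  obtain ⟨c, hc⟩ := h.measure_zpow_image_le h' k
  simpa [h0] using hc A hA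

lemma measure_zpow_image_ne_zero (h : IsCompositionSystem μ φ) (h' : IsCompositionSystem μ φ⁻¹)
    (k : ℤ) {A : Set X} (hA : MeasurableSet A) (h0 : μ A ≠ 0) :
    μ ((φ ^ k : Equiv.Perm X) '' A) ≠ 0 := fun hk => h0 <| by
  have := h.measure_zpow_image_eq_zero h' (-k) (h.measurableSet_zpow_image k hA) hk
  simpa [Equiv.Perm.zpow_image_zpow_image] using this

end IsCompositionSystem

end Levels

/-- An invertible dissipative system of bounded distortion, for a Young function that is finite at
some positive point. -/
structure IsDistortionSystem (Φ : YoungFunction) (μ : Measure X) (φ : Equiv.Perm X) (W : Set X) :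
    Prop where
  comp : IsCompositionSystem μ φ
  comp_inv : IsCompositionSystem μ φ⁻¹
  exists_ne_top : ∃ x, 0 < x ∧ Φ x ≠ ∞
  dissipative : IsDissipative μ φ W
  distortion : HasBoundedDistortion Φ μ φ W

/-! ### Measure contraction and doubling from decay of the gauges -/

namespace IsDistortionSystem

variable {μ : Measure X} {φ : Equiv.Perm X} {Φ : YoungFunction} {W : Set X}

lemma inv (h : IsDistortionSystem Φ μ φ W) : IsDistortionSystem Φ μ φ⁻¹ W where
  comp := h.comp_inv
  comp_inv := by rw [inv_inv]; exact h.comp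
  exists_ne_top := h.exists_ne_top
  dissipative := h.dissipative.inv
  distortion := h.distortion.inv

lemma measurableSet_level (h : IsDistortionSystem Φ μ φ W) (k : ℤ) :
    MeasurableSet ((φ ^ k : Equiv.Perm X) '' W) :=
  h.comp.measurableSet_zpow_image k h.dissipative.measurableSet

lemma measure_level_ne_top (h : IsDistortionSystem Φ μ φ W) (k : ℤ) :
    μ ((φ ^ k : Equiv.Perm X) '' W) ≠ ∞ :=
  h.comp.measure_zpow_image_ne_top h.comp_inv k h.dissipative.measurableSet
    h.dissipative.lt_top.ne

lemma measure_level_ne_zero (h : IsDistortionSystem Φ μ φ W) (k : ℤ) :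
    μ ((φ ^ k : Equiv.Perm X) '' W) ≠ 0 :=
  h.comp.measure_zpow_image_ne_zero h.comp_inv k h.dissipative.measurableSet
    h.dissipative.pos.ne'

lemma levelGauge_pos (h : IsDistortionSystem Φ μ φ W) (k : ℤ) : 0 < levelGauge Φ μ φ W k :=
  indicatorGauge_pos h.exists_ne_top (h.measurableSet_level k) (h.measure_level_ne_top k)
    (h.measure_level_ne_zero k)

lemma orbitInverse_eq (h : IsDistortionSystem Φ μ φ W) (k : ℤ) :
    orbitInverse Φ μ φ W k = ENNReal.ofReal (levelGauge Φ μ φ W k)⁻¹ :=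
  inverse_eq_indicatorGauge h.exists_ne_top (h.measurableSet_level k) (h.measure_level_ne_top k)
    (h.measure_level_ne_zero k)

/-- The upper distortion bound at one level and the lower bound at another share the normalization
at level `0`, which cancels. So ratios of gauges between two levels are controlled by those of `W`,
with the square of the distortion constant. -/
lemma indicatorGauge_mul_le (h : IsDistortionSystem Φ μ φ W) :
    ∃ K : ℝ, 0 < K ∧ ∀ (F : Set X), MeasurableSet F → F ⊆ W → 0 < μ F → ∀ i j : ℤ,
      indicatorGauge Φ μ ((φ ^ i : Equiv.Perm X) '' F) * levelGauge Φ μ φ W j ≤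
        K * (levelGauge Φ μ φ W i * indicatorGauge Φ μ ((φ ^ j : Equiv.Perm X) '' F)) := by
  obtain ⟨K, hK, hd⟩ := h.distortion
  refine ⟨K ^ 2, by positivity, fun F hF hFW hpos i j => ?_⟩
  have hfin : μ F ≠ ∞ := ((measure_mono hFW).trans_lt h.dissipative.lt_top).ne
  have hR : ∀ k : ℤ, 0 < indicatorGauge Φ μ ((φ ^ k : Equiv.Perm X) '' F) := fun k =>
    indicatorGauge_pos h.exists_ne_top (h.comp.measurableSet_zpow_image k hF)
      (h.comp.measure_zpow_image_ne_top h.comp_inv k hF hfin)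
      (h.comp.measure_zpow_image_ne_zero h.comp_inv k hF hpos.ne')
  have hi := (hd (-i) F hF hFW hpos).2
  have hj := (hd (-j) F hF hFW hpos).1
  simp only [indicatorNorm_eq, neg_neg, neg_zero] at hi hj
  change _ ≤ K * (levelGauge Φ μ φ W i / levelGauge Φ μ φ W 0) at hi
  change 1 / K * (levelGauge Φ μ φ W j / levelGauge Φ μ φ W 0) ≤ _ at hj
  have hR0 := hR 0
  have hRj := hR j
  have h0 := h.levelGauge_pos 0
  have hwi := h.levelGauge_pos i
  have hwj := h.levelGauge_pos j
  set R := indicatorGauge Φ μ ((φ ^ (0 : ℤ) : Equiv.Perm X) '' F)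
  set w := levelGauge Φ μ φ W
  rw [div_le_iff₀ hR0] at hi
  rw [one_div, inv_mul_le_iff₀ hK, div_le_iff₀ h0] at hj
  calc _ ≤ (K * (w i / w 0) * R) *
        (K * (indicatorGauge Φ μ ((φ ^ j : Equiv.Perm X) '' F) / R) * w 0) := by gcongr
    _ = _ := by field_simp

/-- Along levels where the gauges decay, `φ` contracts the measure. -/
lemma exists_measure_preimage_le (h : IsDistortionSystem Φ μ φ W) {J : Set ℤ}
    (hJ : ∀ t : ℝ, 0 < t → ∃ n : ℕ, ∀ k ∈ J, levelGauge Φ μ φ W (k - n) ≤ t * levelGauge Φ μ φ W k)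
    {t : ℝ≥0} (ht : 0 < t) :
    ∃ n : ℕ, ∀ A : Set X, MeasurableSet A → A ⊆ ⋃ k ∈ J, (φ ^ k : Equiv.Perm X) '' W →
      μ ((φ ^ n : Equiv.Perm X) ⁻¹' A) ≤ t * μ A := by
  obtain ⟨K, hK, hd⟩ := h.indicatorGauge_mul_le
  -- The comparison of measures needs a factor at most one. In `s / (2 * K)` below, `K` pays for the
  -- distortion and `2` for the passage from gauges to measures.
  set s : ℝ≥0 := min t 1 with hs
  have hs0 : 0 < s := lt_min ht one_pos
  have hs0' : (0 : ℝ) < s := hs0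
  obtain ⟨n, hn⟩ := hJ (s / (2 * K)) (by positivity)
  have hlevel : ∀ k ∈ J, ∀ A : Set X, MeasurableSet A → A ⊆ (φ ^ k : Equiv.Perm X) '' W →
      μ ((φ ^ n : Equiv.Perm X) ⁻¹' A) ≤ t * μ A := by
    intro k hk A hA hAW
    set F := (φ ^ (-k) : Equiv.Perm X) '' A with hF
    have hFm : MeasurableSet F := h.comp.measurableSet_zpow_image _ hA
    have hFW : F ⊆ W := by
      have := Set.image_mono (f := (φ ^ (-k) : Equiv.Perm X)) hAW
      rwa [Equiv.Perm.zpow_image_zpow_image, neg_add_cancel, zpow_zero, Equiv.Perm.coe_one,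
        Set.image_id] at this
    have eA : A = (φ ^ k : Equiv.Perm X) '' F := by
      simp [hF]
    have ePre : (φ ^ n : Equiv.Perm X) ⁻¹' A = (φ ^ (k - n) : Equiv.Perm X) '' F := by
      rw [← zpow_natCast, Equiv.Perm.zpow_preimage, hF, Equiv.Perm.zpow_image_zpow_image]
      congr 3
      ring
    have hfin : μ F ≠ ∞ := ((measure_mono hFW).trans_lt h.dissipative.lt_top).ne
    rcases eq_or_ne (μ F) 0 with h0 | h0
    · rw [ePre, h.comp.measure_zpow_image_eq_zero h.comp_inv _ hFm h0]
      exact zero_le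
    · rw [ePre]
      have hN : 0 < indicatorGauge Φ μ A := by
        rw [eA]
        exact indicatorGauge_pos h.exists_ne_top (h.comp.measurableSet_zpow_image k hFm)
          (h.comp.measure_zpow_image_ne_top h.comp_inv k hFm hfin)
          (h.comp.measure_zpow_image_ne_zero h.comp_inv k hFm h0)
      refine (measure_le_of_indicatorGauge_le (A := A) h.exists_ne_top hA
        (h.comp.measurableSet_zpow_image _ hFm)
        (h.comp.measure_zpow_image_ne_top h.comp_inv _ hFm hfin) hN hs0 (min_le_right _ _)
        ?_).trans (by gcongr; exact min_le_left _ _)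
      have h1 := hd F hFm hFW (pos_iff_ne_zero.2 h0) (k - n) k
      rw [← eA] at h1
      have hw := h.levelGauge_pos k
      refine le_of_mul_le_mul_right (h1.trans ?_) hw
      calc K * (levelGauge Φ μ φ W (k - n) * indicatorGauge Φ μ A)
          ≤ K * (s / (2 * K) * levelGauge Φ μ φ W k * indicatorGauge Φ μ A) := by
            gcongr; exact hn k hk
        _ = _ := by field_simp
  refine ⟨n, fun A hA hAJ => ?_⟩
  have hpiece : ∀ k : ℤ, MeasurableSet (A ∩ (φ ^ k : Equiv.Perm X) '' W) := fun k =>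
    hA.inter (h.measurableSet_level k)
  have eA : ⋃ k : ℤ, A ∩ (φ ^ k : Equiv.Perm X) '' W = A := by
    rw [← Set.inter_iUnion, h.dissipative.iUnion_eq, Set.inter_univ]
  have hle : ∀ k : ℤ, μ ((φ ^ n : Equiv.Perm X) ⁻¹' (A ∩ (φ ^ k : Equiv.Perm X) '' W)) ≤
      t * μ (A ∩ (φ ^ k : Equiv.Perm X) '' W) := fun k => by
    by_cases hk : k ∈ J
    · exact hlevel k hk _ (hpiece k) Set.inter_subset_right
    · have hempty : A ∩ (φ ^ k : Equiv.Perm X) '' W = ∅ := by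
        refine Set.eq_empty_iff_forall_notMem.2 fun x hx => ?_
        obtain ⟨j, hj, hxj⟩ := Set.mem_iUnion₂.1 (hAJ hx.1)
        have hjk : j ≠ k := fun e => hk (e ▸ hj)
        exact Set.disjoint_left.1 (h.dissipative.disjoint hjk) hxj hx.2
      simp [hempty]
  calc μ ((φ ^ n : Equiv.Perm X) ⁻¹' A)
      = μ (⋃ k : ℤ, (φ ^ n : Equiv.Perm X) ⁻¹' (A ∩ (φ ^ k : Equiv.Perm X) '' W)) := by
        rw [← Set.preimage_iUnion, eA]
    _ ≤ ∑' k : ℤ, μ ((φ ^ n : Equiv.Perm X) ⁻¹' (A ∩ (φ ^ k : Equiv.Perm X) '' W)) :=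
        measure_iUnion_le _
    _ ≤ ∑' k : ℤ, t * μ (A ∩ (φ ^ k : Equiv.Perm X) '' W) := ENNReal.tsum_le_tsum hle
    _ = t * ∑' k : ℤ, μ (A ∩ (φ ^ k : Equiv.Perm X) '' W) := ENNReal.tsum_mul_left
    _ = t * μ A := by
        rw [← measure_iUnion (fun j k hjk => ((h.dissipative.disjoint hjk).mono
          Set.inter_subset_right Set.inter_subset_right)) hpiece, eA]

/-- Decay of the gauges along the levels forces a doubling condition on `Φ`. -/
lemma doubling_of_levelGauge (h : IsDistortionSystem Φ μ φ W) {n : ℕ} {c : ℝ≥0}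
    (hc : ∀ A : Set X, MeasurableSet A → μ ((φ ^ (2 * n : ℤ) : Equiv.Perm X) '' A) ≤ c * μ A)
    {i₀ : ℤ} (hn : ∀ k ≤ i₀, levelGauge Φ μ φ W (k - n) ≤ 1 / 4 * levelGauge Φ μ φ W k)
    {v : ℝ} (hv : 0 < v) (hi₀ : v⁻¹ < levelGauge Φ μ φ W i₀) : Φ (2 * v) ≤ c * Φ v := by
  set w := levelGauge Φ μ φ W with hw
  -- Descend from `i₀` in steps of `n` and let `i` be the last level before the gauge first drops to
  -- `1 / v`. The gauge exceeds `1 / v` at `i`, while two steps lower it is at most `1 / (4 * v) < 1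
  -- / (2 * v)`. Thus `Φ v` times the measure of the first level exceeds one, `Φ (2 * v)` times that
  -- of the second is at most one, and `hc` compares the measures.
  have hex : ∃ m : ℕ, w (i₀ - m * n) ≤ v⁻¹ :=
    (exists_lt_of_step hn (inv_pos.2 hv)).imp fun _ h => h.le
  obtain ⟨m, hm⟩ : ∃ m, Nat.find hex = m + 1 := by
    refine Nat.exists_eq_succ_of_ne_zero fun h0 => ?_
    have := Nat.find_spec hex
    rw [h0] at this
    simp only [Nat.cast_zero, zero_mul, sub_zero] at this
    exact absurd hi₀ (not_lt.2 this)
  set i : ℤ := i₀ - m * n with hi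
  have hmn : (0 : ℤ) ≤ m * n := by positivity
  have h1 : v⁻¹ < w i := not_le.1 (Nat.find_min hex (by omega))
  have h2 : w (i - n) ≤ v⁻¹ := by
    have := Nat.find_spec hex
    rw [hm] at this
    convert this using 2
    push_cast; ring
  have h3 : w (i - 2 * n) < (2 * v)⁻¹ := by
    have h4 := hn (i - n) (by omega)
    have e : i - n - n = i - 2 * (n : ℤ) := by ring
    rw [e] at h4
    have := inv_pos.2 hv
    calc w (i - 2 * n) ≤ 1 / 4 * v⁻¹ := h4.trans (by gcongr)
      _ < 1 / 2 * v⁻¹ := by gcongr; norm_num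
      _ = (2 * v)⁻¹ := by rw [mul_inv]; norm_num
  have h5 := one_lt_of_lt_indicatorGauge (h.measurableSet_level i) (inv_pos.2 hv) h1
  have h6 := le_one_of_indicatorGauge_lt h.exists_ne_top (h.measurableSet_level (i - 2 * n))
    (h.measure_level_ne_top _) h3
  rw [inv_inv] at h5 h6
  have h7 := hc _ (h.measurableSet_level (i - 2 * n))
  rw [Equiv.Perm.zpow_image_zpow_image, add_sub_cancel] at h7
  calc Φ (2 * v) ≤ Φ (2 * v) * (Φ v * μ ((φ ^ i : Equiv.Perm X) '' W)) :=
        le_mul_of_one_le_right' h5.le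
    _ ≤ Φ (2 * v) * (Φ v * (c * μ ((φ ^ (i - 2 * n) : Equiv.Perm X) '' W))) := by gcongr
    _ = c * Φ v * (Φ (2 * v) * μ ((φ ^ (i - 2 * n) : Equiv.Perm X) '' W)) := by ring
    _ ≤ c * Φ v * 1 := by gcongr
    _ = c * Φ v := mul_one _

/-- Some level has gauge below `1 / y`, where `y = |x| + 1`. There `Φ y` times a positive measure is
at most one, so `Φ y` is finite. -/
lemma ne_top_of_levelGauge (h : IsDistortionSystem Φ μ φ W) {n : ℕ} {i₀ : ℤ}
    (hn : ∀ k ≤ i₀, levelGauge Φ μ φ W (k - n) ≤ 1 / 4 * levelGauge Φ μ φ W k) (x : ℝ) :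
    Φ x ≠ ∞ := by
  rw [← Φ.map_abs]
  have hx : |x| < |x| + 1 := lt_add_one _
  have hx0 : 0 < |x| + 1 := by positivity
  refine ((Φ.mono (abs_nonneg x) hx.le).trans_lt ?_).ne
  obtain ⟨m, hm⟩ := exists_lt_of_step hn (inv_pos.2 hx0)
  have h6 := le_one_of_indicatorGauge_lt h.exists_ne_top (h.measurableSet_level _)
    (h.measure_level_ne_top _) hm
  rw [inv_inv] at h6
  by_contra hne
  rw [not_lt_top_iff.1 hne, ENNReal.top_mul (h.measure_level_ne_zero _)] at h6
  exact absurd h6 (by simp)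

end IsDistortionSystem

/-! ### From measure contraction to norm contraction -/

namespace IsCompositionSystem

variable {μ : Measure X} {φ : Equiv.Perm X} {Φ : YoungFunction}

/-- If powers of `φ` contract the measure on subsets of `S` and `Φ` is doubling up to a summable
error on `S`, then a power of `C_φ` contracts the functions supported in `S`. -/
lemma exists_contraction (h : IsCompositionSystem μ φ) {S : Set X} (hS : MeasurableSet S)
    (hμ : ∀ t : ℝ≥0, 0 < t → ∃ n : ℕ, ∀ A : Set X, MeasurableSet A → A ⊆ S →
      μ ((φ ^ n : Equiv.Perm X) ⁻¹' A) ≤ t * μ A)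
    {D : ℝ≥0} {b : ℝ≥0∞} (hD : ∀ v, Φ (2 * v) ≤ D * Φ v + b) (hb : b * μ S ≠ ∞) :
    ∃ n : ℕ, ∀ f : OrliczSpace Φ μ, (∀ᵐ x ∂μ, x ∉ S → (f : X →ₘ[μ] ℝ) x = 0) →
      ‖(h.compositionOperator Φ ^ n) f‖ ≤ 1 / 2 * ‖f‖ := by
  -- `D + b * μ S` bounds the integral of `Φ (2 * f / a)` over `S` once `f / a` has modular at most
  -- one; the final `1` keeps `B` positive.
  set B : ℝ≥0 := D + (b * μ S).toNNReal + 1 with hB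
  have hB0 : 0 < B := by positivity
  obtain ⟨n, hn⟩ := hμ B⁻¹ (inv_pos.2 hB0)
  refine ⟨n, fun f hf => OrliczSpace.norm_le_mul_of_modular (by norm_num) fun a ha hfa => ?_⟩
  set g : X → ℝ≥0∞ := fun x => Φ (2 * ((f : X →ₘ[μ] ℝ) x / a)) with hg
  have hgm : Measurable g := Φ.measurable.comp
    (((f : X →ₘ[μ] ℝ).stronglyMeasurable.measurable.div_const a).const_mul 2)
  have hq := h.quasi_pow n
  have hg0 : ∀ᵐ x ∂(μ.map (φ ^ n : Equiv.Perm X)), x ∉ S → g x = 0 := by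
    filter_upwards [hq.absolutelyContinuous.ae_le hf] with x hx hxS
    simp [hg, hx hxS, Φ.map_zero]
  have hrestrict : (μ.map (φ ^ n : Equiv.Perm X)).restrict S ≤
      ((B⁻¹ : ℝ≥0) : ℝ≥0∞) • μ.restrict S := by
    refine Measure.le_iff.2 fun A hA => ?_
    rw [Measure.restrict_apply hA, Measure.map_apply hq.measurable (hA.inter hS),
      Measure.smul_apply, Measure.restrict_apply hA, smul_eq_mul]
    exact hn _ (hA.inter hS) Set.inter_subset_right
  calc orliczModular Φ μ
        (fun x => ((h.compositionOperator Φ ^ n) f : X →ₘ[μ] ℝ) x / (1 / 2 * a))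
      = ∫⁻ x, g ((φ ^ n : Equiv.Perm X) x) ∂μ := by
        refine lintegral_congr_ae ?_
        filter_upwards [h.compositionOperator_pow_ae Φ n f] with x hx
        simp only [hx, hg, Function.comp_apply]
        congr 1
        field_simp
    _ = ∫⁻ x, g x ∂(μ.map (φ ^ n : Equiv.Perm X)) := (lintegral_map hgm hq.measurable).symm
    _ = ∫⁻ x in S, g x ∂(μ.map (φ ^ n : Equiv.Perm X)) := by
        rw [← lintegral_indicator hS]
        refine lintegral_congr_ae ?_
        filter_upwards [hg0] with x hx
        by_cases hxS : x ∈ S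
        · simp [hxS]
        · simp [hxS, hx hxS]
    _ ≤ ∫⁻ x, g x ∂(((B⁻¹ : ℝ≥0) : ℝ≥0∞) • μ.restrict S) := lintegral_mono' hrestrict le_rfl
    _ = ((B⁻¹ : ℝ≥0) : ℝ≥0∞) * ∫⁻ x in S, g x ∂μ := by
        rw [lintegral_smul_measure, smul_eq_mul]
    _ ≤ ((B⁻¹ : ℝ≥0) : ℝ≥0∞) *
        ∫⁻ x in S, (D * Φ ((f : X →ₘ[μ] ℝ) x / a) + b) ∂μ := by
        gcongr with x
        exact hD _
    _ = ((B⁻¹ : ℝ≥0) : ℝ≥0∞) *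
        (D * ∫⁻ x in S, Φ ((f : X →ₘ[μ] ℝ) x / a) ∂μ + b * μ S) := by
        rw [lintegral_add_right _ measurable_const, lintegral_const_mul' _ _ ENNReal.coe_ne_top]
        simp
    _ ≤ ((B⁻¹ : ℝ≥0) : ℝ≥0∞) * (D * 1 + b * μ S) := by
        gcongr
        exact (setLIntegral_le_lintegral _ _).trans hfa
    _ ≤ ((B⁻¹ : ℝ≥0) : ℝ≥0∞) * B := by
        gcongr
        rw [hB, mul_one]
        push_cast
        rw [ENNReal.coe_toNNReal hb]
        exact le_self_add
    _ = 1 := by rw [← ENNReal.coe_mul, inv_mul_cancel₀ hB0.ne', ENNReal.coe_one]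

end IsCompositionSystem

namespace IsDistortionSystem

variable {μ : Measure X} {φ : Equiv.Perm X} {Φ : YoungFunction} {W : Set X}

/-- The gauges are unbounded towards positive indices, so every `v > 0` has a starting level for the
doubling argument. Doubling then holds with `b = 0`, and no finiteness of `μ` is needed. -/
lemma exists_contraction_univ (h : IsDistortionSystem Φ μ φ W)
    (hw : ∀ t : ℝ, 0 < t → ∃ n : ℕ, ∀ k : ℤ,
      levelGauge Φ μ φ W k ≤ t * levelGauge Φ μ φ W (k + n)) :
    ∃ n : ℕ, ∀ f : OrliczSpace Φ μ, ‖(h.comp.compositionOperator Φ ^ n) f‖ ≤ 1 / 2 * ‖f‖ := by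
  have hw' : ∀ t : ℝ, 0 < t → ∃ n : ℕ, ∀ k : ℤ,
      levelGauge Φ μ φ W (k - n) ≤ t * levelGauge Φ μ φ W k := fun t ht =>
    (hw t ht).imp fun n hn k => by simpa using hn (k - n)
  obtain ⟨n, hn⟩ := hw' (1 / 4) (by norm_num)
  obtain ⟨c, hc⟩ := h.comp.measure_zpow_image_le h.comp_inv (2 * n)
  have hdouble : ∀ v, 0 < v → Φ (2 * v) ≤ c * Φ v := fun v hv => by
    obtain ⟨m, hm⟩ : ∃ m : ℕ, v⁻¹ < levelGauge Φ μ φ W (m * n) := by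
      have hw0 := h.levelGauge_pos 0
      obtain ⟨m, hm⟩ := pow_unbounded_of_one_lt (v⁻¹ / levelGauge Φ μ φ W 0)
        (by norm_num : (1 : ℝ) < 4)
      refine ⟨m, ?_⟩
      have h1 := le_pow_mul_of_step (w := levelGauge Φ μ φ W) (i := m * n) (t := 1 / 4)
        (by norm_num) (fun k _ => hn k) m
      rw [sub_self, one_div, inv_pow, le_inv_mul_iff₀ (by positivity)] at h1
      rw [div_lt_iff₀ hw0] at hm
      exact hm.trans_le h1
    exact h.doubling_of_levelGauge hc (fun k _ => hn k) hv hm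
  suffices hs : ∃ m : ℕ, ∀ f : OrliczSpace Φ μ,
      (∀ᵐ x ∂μ, x ∉ Set.univ → (f : X →ₘ[μ] ℝ) x = 0) →
        ‖(h.comp.compositionOperator Φ ^ m) f‖ ≤ 1 / 2 * ‖f‖ from
    hs.imp fun m hm f => hm f (by simp)
  refine h.comp.exists_contraction (S := Set.univ) MeasurableSet.univ
    (fun t ht => ?_) (D := c) (b := 0) (fun v => ?_) (by simp)
  · obtain ⟨m, hm⟩ := h.exists_measure_preimage_le (J := Set.univ)
      (fun t ht => (hw' t ht).imp fun n hn k _ => hn k) ht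
    refine ⟨m, fun A hA _ => hm A hA ?_⟩
    simp [h.dissipative.iUnion_eq]
  · rw [add_zero, ← Φ.map_abs v, ← Φ.map_abs (2 * v), abs_mul, abs_two]
    rcases (abs_nonneg v).eq_or_lt with h0 | h0
    · simp [← h0, Φ.map_zero]
    · exact hdouble _ h0

/-- Starting from level `0`, doubling is available only above `(levelGauge Φ μ φ W 0)⁻¹`. Smaller
arguments cost a constant, which is harmless because `S` has finite measure. -/
lemma exists_contraction_half (h : IsDistortionSystem Φ μ φ W)
    (hw : ∀ t : ℝ, 0 < t → ∃ n : ℕ, ∀ k : ℤ, k ≤ 0 →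
      levelGauge Φ μ φ W (k - n) ≤ t * levelGauge Φ μ φ W k)
    {S : Set X} (hS : MeasurableSet S)
    (hSW : S ⊆ ⋃ k ∈ Set.Iic (0 : ℤ), (φ ^ k : Equiv.Perm X) '' W) :
    ∃ n : ℕ, ∀ f : OrliczSpace Φ μ, (∀ᵐ x ∂μ, x ∉ S → (f : X →ₘ[μ] ℝ) x = 0) →
      ‖(h.comp.compositionOperator Φ ^ n) f‖ ≤ 1 / 2 * ‖f‖ := by
  obtain ⟨n, hn⟩ := hw (1 / 4) (by norm_num)
  obtain ⟨c, hc⟩ := h.comp.measure_zpow_image_le h.comp_inv (2 * n)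
  have hμ := fun (t : ℝ≥0) (ht : 0 < t) => h.exists_measure_preimage_le (J := Set.Iic 0) hw ht
  have hw0 := h.levelGauge_pos 0
  have hfinS : μ S ≠ ∞ := by
    -- Halving the measure every `m` levels makes the measures of the levels of nonpositive index
    -- summable.
    obtain ⟨m, hm⟩ := hμ (1 / 2) (by norm_num)
    have hsum : Summable fun k : ℕ => (μ ((φ ^ (-k : ℤ) : Equiv.Perm X) '' W)).toReal := by
      refine summable_of_add_le_half (fun _ => ENNReal.toReal_nonneg) (n := m) fun k => ?_
      have h1 := hm _ (h.measurableSet_level (-k))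
        (Set.subset_biUnion_of_mem (u := fun k : ℤ => (φ ^ k : Equiv.Perm X) '' W)
          (show (-k : ℤ) ∈ Set.Iic (0 : ℤ) by simp))
      rw [← zpow_natCast, Equiv.Perm.zpow_preimage, Equiv.Perm.zpow_image_zpow_image] at h1
      have h2 := ENNReal.toReal_mono
        (ENNReal.mul_ne_top ENNReal.coe_ne_top (h.measure_level_ne_top _)) h1
      rw [ENNReal.toReal_mul] at h2
      have e : (-((m + k : ℕ) : ℤ)) = -m + -k := by push_cast; ring
      rw [e]
      simpa using h2
    refine ne_top_of_le_ne_top hsum.tsum_ofReal_ne_top ?_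
    simp only [ENNReal.ofReal_toReal (h.measure_level_ne_top _)]
    refine (measure_mono (hSW.trans ?_)).trans (measure_iUnion_le _)
    refine Set.iUnion₂_subset fun k hk => ?_
    obtain ⟨p, rfl⟩ : ∃ p : ℕ, k = -p := ⟨k.natAbs, by have : k ≤ 0 := hk; omega⟩
    exact Set.subset_iUnion (fun p : ℕ => (φ ^ (-p : ℤ) : Equiv.Perm X) '' W) p
  refine h.comp.exists_contraction hS (fun t ht => ?_) (D := c)
    (b := Φ (2 * (levelGauge Φ μ φ W 0)⁻¹)) (fun v => ?_)
    (ENNReal.mul_ne_top (h.ne_top_of_levelGauge hn _) hfinS)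
  · exact (hμ t ht).imp fun m hm A hA hAS => hm A hA (hAS.trans hSW)
  · rw [← Φ.map_abs v, ← Φ.map_abs (2 * v), abs_mul, abs_two]
    rcases le_or_gt |v| (levelGauge Φ μ φ W 0)⁻¹ with h1 | h1
    · exact (Φ.mono (by positivity) (by gcongr)).trans le_add_self
    · have h0 : 0 < |v| := (inv_pos.2 hw0).trans h1
      exact (h.doubling_of_levelGauge hc hn h0 (inv_lt_of_inv_lt₀ hw0 h1)).trans le_self_add

theorem isStronglyStructurallyStable_of_contraction (h : IsDistortionSystem Φ μ φ W)
    (hw : ∀ t : ℝ, 0 < t → ∃ n : ℕ, ∀ k : ℤ,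
      levelGauge Φ μ φ W k ≤ t * levelGauge Φ μ φ W (k + n)) :
    IsStronglyStructurallyStable (h.comp.compositionOperator Φ) := by
  obtain ⟨n, hn⟩ := hw (1 / 4) (by norm_num)
  have : CompleteSpace (OrliczSpace Φ μ) := OrliczSpace.completeSpace Φ μ
    (h.ne_top_of_levelGauge (n := n) (i₀ := 0) fun k _ => by simpa using hn (k - n))
  -- With `S` the whole space, the complementary functions are zero and the power `0` suffices for
  -- them.
  refine h.comp.isStronglyStructurallyStable_of_set h.comp_inv Φ MeasurableSet.univ
    (fun _ _ => Set.mem_univ _) ((h.exists_contraction_univ hw).imp fun n hn f _ => hn f)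
    ⟨0, fun f hf => ?_⟩
  have : f = 0 := OrliczSpace.ext_ae Φ μ <| by
    filter_upwards [hf, OrliczSpace.coeFn_zero Φ μ] with x hx h0
    rw [h0]
    exact hx (by simp)
  simp [this]

theorem isStronglyStructurallyStable_of_expansion (h : IsDistortionSystem Φ μ φ W)
    (hw : ∀ t : ℝ, 0 < t → ∃ n : ℕ, ∀ k : ℤ,
      levelGauge Φ μ φ W (k + n) ≤ t * levelGauge Φ μ φ W k) :
    IsStronglyStructurallyStable (h.comp.compositionOperator Φ) := by
  have hw' : ∀ t : ℝ, 0 < t → ∃ n : ℕ, ∀ k : ℤ,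
      levelGauge Φ μ φ⁻¹ W k ≤ t * levelGauge Φ μ φ⁻¹ W (k + n) := fun t ht =>
    (hw t ht).imp fun n hn k => by
      simpa [levelGauge_inv, add_comm] using hn (-(k + n))
  obtain ⟨n, hn⟩ := hw' (1 / 4) (by norm_num)
  have : CompleteSpace (OrliczSpace Φ μ) := OrliczSpace.completeSpace Φ μ
    (h.inv.ne_top_of_levelGauge (n := n) (i₀ := 0) fun k _ => by simpa using hn (k - n))
  -- Here `S` is empty, and the contraction of the inverse comes from the system reversed in time.
  refine h.comp.isStronglyStructurallyStable_of_set h.comp_inv Φ MeasurableSet.empty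
    (fun _ hx => hx.elim) ⟨0, fun f hf => ?_⟩
    ((h.inv.exists_contraction_univ hw').imp fun n hn f _ => hn f)
  have : f = 0 := OrliczSpace.ext_ae Φ μ <| by
    filter_upwards [hf, OrliczSpace.coeFn_zero Φ μ] with x hx h0
    rw [h0]
    exact hx (by simp)
  simp [this]

/-- The gauges decay away from `0` on both sides. Split at level `0`: replacing `φ` by its inverse
reverses the levels, so the same half line contraction applies to both pieces. -/
theorem isStronglyStructurallyStable_of_half_lines (h : IsDistortionSystem Φ μ φ W)
    (hw₁ : ∀ t : ℝ, 0 < t → ∃ n : ℕ, ∀ k : ℤ, k ≤ 0 →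
      levelGauge Φ μ φ W (k - n) ≤ t * levelGauge Φ μ φ W k)
    (hw₂ : ∀ t : ℝ, 0 < t → ∃ n : ℕ, ∀ k : ℤ, 0 ≤ k →
      levelGauge Φ μ φ W (k + n) ≤ t * levelGauge Φ μ φ W k) :
    IsStronglyStructurallyStable (h.comp.compositionOperator Φ) := by
  have hw₂' : ∀ t : ℝ, 0 < t → ∃ n : ℕ, ∀ k : ℤ, k ≤ 0 →
      levelGauge Φ μ φ⁻¹ W (k - n) ≤ t * levelGauge Φ μ φ⁻¹ W k := fun t ht =>
    (hw₂ t ht).imp fun n hn k hk => by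
      simpa [levelGauge_inv, add_comm, sub_eq_add_neg] using hn (-k) (by omega)
  obtain ⟨n, hn⟩ := hw₁ (1 / 4) (by norm_num)
  have : CompleteSpace (OrliczSpace Φ μ) := OrliczSpace.completeSpace Φ μ
    (h.ne_top_of_levelGauge hn)
  set S : Set X := ⋃ k ∈ Set.Iic (0 : ℤ), (φ ^ k : Equiv.Perm X) '' W with hSdef
  have hS : MeasurableSet S :=
    MeasurableSet.biUnion (Set.to_countable _) fun k _ => h.measurableSet_level k
  refine h.comp.isStronglyStructurallyStable_of_set h.comp_inv Φ hS (fun x hx => ?_)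
    (h.exists_contraction_half hw₁ hS le_rfl)
    (h.inv.exists_contraction_half hw₂' hS.compl fun x hx => ?_)
  · obtain ⟨k, hk, y, hy, hxy⟩ := Set.mem_iUnion₂.1 hx
    refine Set.mem_iUnion₂.2 ⟨k - 1, by have : k ≤ 0 := hk; simp; omega, y, hy, ?_⟩
    apply φ.injective
    rw [← hxy, ← Equiv.Perm.mul_apply, ← zpow_one_add, add_sub_cancel]
  · have hx' : x ∈ ⋃ k : ℤ, (φ ^ k : Equiv.Perm X) '' W := by
      rw [h.dissipative.iUnion_eq]; trivial
    obtain ⟨k, hk⟩ := Set.mem_iUnion.1 hx'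
    have hk0 : 0 < k := by
      by_contra! hle
      exact hx (Set.mem_iUnion₂.2 ⟨k, hle, hk⟩)
    refine Set.mem_iUnion₂.2 ⟨-k, by simp; omega, ?_⟩
    rwa [Equiv.Perm.inv_zpow_image, neg_neg]

end IsDistortionSystem

/-- A finite modular forces the function to vanish almost everywhere. -/
lemma OrliczSpace.subsingleton_of_eq_top {μ : Measure X} {Φ : YoungFunction}
    (hΦ : ∀ x, 0 < x → Φ x = ∞) : Subsingleton (OrliczSpace Φ μ) := by
  refine subsingleton_of_forall_eq 0 fun f => OrliczSpace.ext_ae Φ μ ?_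
  obtain ⟨k, hk, hf⟩ := f.2
  have hm : Measurable fun x => Φ (k * (f : X →ₘ[μ] ℝ) x) :=
    Φ.measurable.comp ((f : X →ₘ[μ] ℝ).stronglyMeasurable.measurable.const_mul k)
  filter_upwards [ae_lt_top hm hf.ne, OrliczSpace.coeFn_zero Φ μ] with x hx h0
  rw [h0]
  by_contra hne
  rw [← Φ.map_abs, hΦ _ (abs_pos.2 (mul_ne_zero hk.ne' hne))] at hx
  exact absurd hx (lt_irrefl _)

lemma isStronglyStructurallyStable_of_subsingleton {E : Type*} [NormedAddCommGroup E]
    [NormedSpace ℝ E] [Subsingleton E] (T : E →L[ℝ] E) : IsStronglyStructurallyStable T := by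
  refine ⟨ContinuousLinearMap.isUnit_iff_bijective.2
    ⟨fun _ _ _ => Subsingleton.elim _ _, fun x => ⟨x, Subsingleton.elim _ _⟩⟩,
    fun ε hε => ⟨1, one_pos, fun α _ _ => ⟨Homeomorph.refl E, fun x => Subsingleton.elim _ _,
      fun x => ?_⟩⟩⟩
  simpa using hε.le

end DissipativeSystems

/-! ### The rate conditions and the conclusion -/

theorem mainTheorem4 {X : Type*} [MeasurableSpace X] (μ : Measure X) [SigmaFinite μ]
    (Φ : YoungFunction) (hΦ : Φ.DeltaPrime)
    (φ : Equiv.Perm X) (hφ : IsCompositionSystem μ φ)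
    (hinv : ∃ c : ℝ≥0, 0 < c ∧ ∀ A : Set X, MeasurableSet A → μ (φ '' A) ≤ c * μ A)
    (W : Set X) (hW : IsDissipative μ φ W) (hdist : HasBoundedDistortion Φ μ φ W)
    (hcond :
      (limsup (fun n : ℕ => ⨆ k : ℤ,
          (orbitInverse Φ μ φ W (k + n) / orbitInverse Φ μ φ W k) ^ (1 / (n : ℝ))) atTop < 1) ∨
      (1 < liminf (fun n : ℕ => ⨅ k : ℤ,
          (orbitInverse Φ μ φ W (k + n) / orbitInverse Φ μ φ W k) ^ (1 / (n : ℝ))) atTop) ∨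
      (limsup (fun n : ℕ => ⨆ k : {k : ℤ // k ≤ 0},
          (orbitInverse Φ μ φ W k / orbitInverse Φ μ φ W (k - n)) ^ (1 / (n : ℝ))) atTop < 1 ∧
        (1 < liminf (fun n : ℕ => ⨅ k : {k : ℤ // 0 ≤ k},
            (orbitInverse Φ μ φ W (k + n) / orbitInverse Φ μ φ W k) ^ (1 / (n : ℝ))) atTop ∨
          1 < liminf (fun n : ℕ => ⨅ k : {k : ℤ // 0 ≤ k},
            (orbitInverse Φ μ φ W k / orbitInverse Φ μ φ W (k + n)) ^ (1 / (n : ℝ))) atTop))) :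
    IsStronglyStructurallyStable (hφ.compositionOperator Φ) := by
  -- If `Φ` is infinite on all positive reals, the space is trivial. Otherwise indicators of sets of
  -- finite measure belong to it, and their gauges carry information.
  by_cases hfin : ∃ x, 0 < x ∧ Φ x ≠ ∞
  swap
  · push Not at hfin
    have := OrliczSpace.subsingleton_of_eq_top (μ := μ) hfin
    exact isStronglyStructurallyStable_of_subsingleton _
  have h : IsDistortionSystem Φ μ φ W := ⟨hφ, hφ.inverse hinv, hfin, hW, hdist⟩
  have hw := h.levelGauge_pos
  have hu := h.orbitInverse_eq
  rcases hcond with hc | hc | ⟨hc₁, hc₂⟩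
  · exact h.isStronglyStructurallyStable_of_contraction fun t ht =>
      (eventually_le_mul_of_limsup hw hu (i := fun n k => k + n) (j := fun _ k => k) hc ht).exists
  · exact h.isStronglyStructurallyStable_of_expansion fun t ht =>
      (eventually_le_mul_of_liminf hw hu (i := fun n k => k + n) (j := fun _ k => k) hc ht).exists
  have hneg : ∀ t : ℝ, 0 < t → ∀ᶠ n : ℕ in atTop, ∀ k : ℤ, k ≤ 0 →
      levelGauge Φ μ φ W (k - n) ≤ t * levelGauge Φ μ φ W k := fun t ht =>
    (eventually_le_mul_of_limsup hw hu (ι := {k : ℤ // k ≤ 0}) (i := fun _ k => k)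
      (j := fun n k => k - n) hc₁ ht).mono fun n hn k hk => hn ⟨k, hk⟩
  rcases hc₂ with hc | hc
  · exact h.isStronglyStructurallyStable_of_half_lines (fun t ht => (hneg t ht).exists)
      fun t ht => ((eventually_le_mul_of_liminf hw hu (ι := {k : ℤ // 0 ≤ k})
        (i := fun n k => k + n) (j := fun _ k => k) hc ht).mono fun n hn k hk => hn ⟨k, hk⟩).exists
  -- In this alternative the gauges decrease to the left on both half lines, so the operator is in
  -- fact contracting on the whole space.
  · have hpos : ∀ t : ℝ, 0 < t → ∀ᶠ n : ℕ in atTop, ∀ k : ℤ, 0 ≤ k →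
        levelGauge Φ μ φ W k ≤ t * levelGauge Φ μ φ W (k + n) := fun t ht =>
      (eventually_le_mul_of_liminf hw hu (ι := {k : ℤ // 0 ≤ k}) (i := fun _ k => k)
        (j := fun n k => k + n) hc ht).mono fun n hn k hk => hn ⟨k, hk⟩
    exact h.isStronglyStructurallyStable_of_contraction fun t ht =>
      (eventually_le_mul_of_half_lines hw hneg hpos ht).exists
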